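/- \textbf{Setting.} Let $D>1$ be a squarefree integer with an even number of prime factors, let $M\ge 1$ be an integer prime to $D$, and let $p$ be a prime not dividing $DM$. Let $B$ be the quaternion algebra over $\mathbb{Q}$ of discriminant $D$, let $\iota_p\colon B\otimes\mathbb{Q}_p\simeq M_2(\mathbb{Q}_p)$ be an isomorphism, and let $R_0(M)\subset B$ be an Eichler order of level $M$ with $\iota_p(R_0(M)\otimes\mathbb{Z}_p)=M_2(\mathbb{Z}_p)$. Let $R_0(pM)$ be the Eichler order of the $x\in R_0(M)$ such that $\iota_p(x)$ is upper triangular modulo $p$, and let $R=R_0(M)[1/p]$. Denote by $\Gamma_0^D(M)$, $\Gamma^D_0(pM)$ and $\Gamma$ the groups of units of reduced norm $1$ of $R_0(M)$, $R_0(pM)$ and $R$. Put $\Gamma_0^{\mathrm{loc}}(p)=\{\begin{pmatrix}a&b\\c&d\end{pmatrix}\in \mathrm{SL}_2(\mathbb{Z}_p): p\mid c\}$. Fix representatives $\gamma_0=1,\gamma_1,\dots,\gamma_p$ of $\Gamma^D_0(pM)\backslash\Gamma^D_0(M)$ with $\iota_p(\gamma_i)\in\Gamma_0^{\mathrm{loc}}(p)\begin{pmatrix}0&-1\\1&i\end{pmatrix}$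 for $i>0$, and $\omega_p\in R_0(pM)$ that normalizes $\Gamma_0^D(pM)$ with $\iota_p(\omega_p)\in\Gamma_0^{\mathrm{loc}}(p)\begin{pmatrix}0&-1\\p&0\end{pmatrix}$. Put $\tilde\gamma_0=1$ and $\tilde\gamma_i=p^{-1}\omega_p\gamma_i\omega_p$ for $i=1,\dots,p$. \textbf{The tree.} Let $\mathcal{T}$ be the Bruhat--Tits tree of $\mathrm{PGL}_2(\mathbb{Q}_p)$, with vertices the homothety classes of lattices in $\mathbb{Q}_p^2$ and an edge $(v_1,v_2)$ whenever $v_1,v_2$ are represented by lattices with $p\Lambda_1\subsetneq\Lambda_2\subsetneq\Lambda_1$; $\Gamma$ acts on it through $\iota_p$. Let $v_*=[\mathbb{Z}_p\oplus\mathbb{Z}_p]$, $\hat v_*=[\mathbb{Z}_p\oplus p\mathbb{Z}_p]$ and $e_*=(v_*,\hat v_*)$. A vertex is even if its distance $d(\cdot,v_*)$ is even, and a directed edge $e$, with source $s(e)$, target $t(e)$ and opposite $\bar e$, is even if $s(e)$ is even. It is inward if $d(t(e),v_*)<d(s(e),v_*)$, and outward if $d(s(e),v_*)<d(t(e),v_*)$.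 Let $e\mapsto U_e$ be the $\mathrm{GL}_2(\mathbb{Q}_p)$-equivariant bijection from directed edges to compact-open balls of $\mathbb{P}^1(\mathbb{Q}_p)$ with $U_{e_*}=\mathbb{Z}_p$. \textbf{The radial system.} Let $\mathcal Y=\{\gamma_e\}$ ($e$ even) and $\{\gamma_v\}$ be the families in $\Gamma$ determined by: $\gamma_e^{-1}e_*=e$; $\gamma_v^{-1}v_*=v$ for $v$ even and $\gamma_v^{-1}\hat v_*=v$ for $v$ odd; $\gamma_{v_*}=\gamma_{\hat v_*}=1$; $\{\gamma_e\}_{s(e)=v}=\{\gamma_i\gamma_v\}_{i=0}^p$ for $v$ even; $\{\gamma_e\}_{t(e)=v}=\{\tilde\gamma_i\gamma_v\}_{i=0}^p$ for $v$ odd; $\gamma_{s(e)}=\gamma_e$ if $e$ is even and inward; $\gamma_{t(e)}=\gamma_e$ if $e$ is even and outward. \textbf{The measures.} Let $\varphi\colon\Gamma_0^D(pM)\to\mathbb{Z}$ be a homomorphism. For $g\in\Gamma$ and $e$ even define $h(g,e)\in\Gamma_0^D(pM)$ by $\gamma_e g=h(g,e)\gamma_{g^{-1}e}$, and define $\mu_g$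 on directed edges by $\mu_g(e)=\varphi(h(g,e))$ if $e$ is even and $\mu_g(e)=-\mu_g(\bar e)$ if $e$ is odd. When $\mu_g$ is harmonic it is identified with the $\mathbb{Z}$-valued (finitely additive) measure of total mass $0$ on $\mathbb{P}^1(\mathbb{Q}_p)$ such that $\mu_g(U_e)=\mu_g(e)$ for all $e$. \textbf{Proposition.} Let $g\in\Gamma$ be such that $g^{-1}(e_*)$ is an inward edge. Then $g$ can be written as $g=g_0\gamma$ with $g_0\in\Gamma_0^D(pM)$ and $\gamma\in\mathcal Y$ a finite alternating product $$\gamma=\tilde\gamma_t\,\gamma_{i_1}\tilde\gamma_{i_2}\gamma_{i_3}\cdots,\qquad t,i_1,\dots,i_n\in\{1,\dots,p\},\ n\ge 0 .$$ For every $g_0\in\Gamma_0^D(pM)$ and every $\gamma$ of this form with $g=g_0\gamma$, $\mu_g$ and $\mu_{g_0}$ coincide when restricted to $\mathbb{Z}_p$: $\mu_g(e)=\mu_{g_0}(e)$ for every directed edge $e$ with $U_e\subseteq\mathbb{Z}_p$, and, whenever $\mu_g$ and $\mu_{g_0}$ come from measures, these measures agree on every compact-open $U\subseteq\mathbb{Z}_p$.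 -/

import Mathlib

open scoped Quaternion TensorProduct Pointwise

noncomputable section

namespace DarmonPoints

/-! ### Quaternion algebras over `ℚ` and their orders -/

section Quaternion

variable {a b : ℚ}

/-- The reduced norm `x * conj x` of the quaternion algebra `(a, b / ℚ)`. -/
def nrd (x : ℍ[ℚ,a,b]) : ℚ := (x * star x).re

theorem mul_star_eq_nrd (x : ℍ[ℚ,a,b]) : x * star x = algebraMap ℚ ℍ[ℚ,a,b] (nrd x) :=
  QuaternionAlgebra.mul_star_eq_coe x

theorem nrd_mul (x y : ℍ[ℚ,a,b]) : nrd (x * y) = nrd x * nrd y := by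
  simp [nrd]; ring

theorem nrd_one : nrd (1 : ℍ[ℚ,a,b]) = 1 := by simp [nrd]

/-- `B = (a, b / ℚ)` is split at `ℓ` : `B ⊗ ℚ_ℓ` is isomorphic to `M₂(ℚ_ℓ)`. -/
def IsSplitAt (a b : ℚ) (ℓ : ℕ) [Fact ℓ.Prime] : Prop :=
  Nonempty (ℚ_[ℓ] ⊗[ℚ] ℍ[ℚ,a,b] ≃ₐ[ℚ_[ℓ]] Matrix (Fin 2) (Fin 2) ℚ_[ℓ])

/-- `(a, b / ℚ)` is a quaternion algebra of discriminant `D`: `D` is squarefree and its prime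
divisors are exactly the primes at which the algebra is ramified (i.e. not split). -/
structure HasDiscriminant (a b : ℚ) (D : ℕ) : Prop where
  a_ne_zero : a ≠ 0
  b_ne_zero : b ≠ 0
  squarefree : Squarefree D
  dvd_iff : ∀ (ℓ : ℕ) [Fact ℓ.Prime], ℓ ∣ D ↔ ¬ IsSplitAt a b ℓ

/-- A `ℤ`-order: a subring, finitely generated over `ℤ`, that spans the algebra over `ℚ`. -/
structure IsOrder (O : Subring ℍ[ℚ,a,b]) : Prop where
  fg : O.toAddSubgroup.FG
  span_eq_top : Submodule.span ℚ (O : Set ℍ[ℚ,a,b]) = ⊤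

/-- A maximal order. -/
structure IsMaximalOrder (O : Subring ℍ[ℚ,a,b]) : Prop where
  isOrder : IsOrder O
  maximal : ∀ O' : Subring ℍ[ℚ,a,b], IsOrder O' → O ≤ O' → O' = O

/-- An Eichler order of level `M`: an intersection `O₁ ∩ O₂` of two maximal orders, of index `M`
in `O₁`. -/
def IsEichlerOrder (O : Subring ℍ[ℚ,a,b]) (M : ℕ) : Prop :=
  ∃ O₁ O₂ : Subring ℍ[ℚ,a,b], IsMaximalOrder O₁ ∧ IsMaximalOrder O₂ ∧ O = O₁ ⊓ O₂ ∧
    O.toAddSubgroup.relIndex O₁.toAddSubgroup = M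

/-- The group `O₁ˣ` of units of reduced norm `1` of a subring `O`. -/
def normOneUnits (O : Subring ℍ[ℚ,a,b]) : Subgroup (ℍ[ℚ,a,b])ˣ where
  carrier := {u | (u : ℍ[ℚ,a,b]) ∈ O ∧ ((u⁻¹ : (ℍ[ℚ,a,b])ˣ) : ℍ[ℚ,a,b]) ∈ O ∧
    nrd (u : ℍ[ℚ,a,b]) = 1}
  one_mem' := by simp [nrd_one, O.one_mem]
  mul_mem' := by
    rintro u v ⟨hu, hu', hu''⟩ ⟨hv, hv', hv''⟩
    refine ⟨?_, ?_, ?_⟩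
    · simpa using O.mul_mem hu hv
    · simpa using O.mul_mem hv' hu'
    · simp [nrd_mul, hu'', hv'']
  inv_mem' := by
    rintro u ⟨hu, hu', hu''⟩
    refine ⟨hu', by simpa using hu, ?_⟩
    have h : nrd ((u : ℍ[ℚ,a,b]) * ((u⁻¹ : (ℍ[ℚ,a,b])ˣ) : ℍ[ℚ,a,b])) = 1 := by
      rw [Units.mul_inv, nrd_one]
    rwa [nrd_mul, hu'', one_mul] at h

/-- The subring `O[1/p]` of `B`, that is, `O ⊗ ℤ[1/p]`. -/
def invertP (p : ℕ) (O : Subring ℍ[ℚ,a,b]) : Subring ℍ[ℚ,a,b] where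
  carrier := {x | ∃ k : ℕ, (p ^ k) • x ∈ O}
  one_mem' := ⟨0, by simp [O.one_mem]⟩
  zero_mem' := ⟨0, by simp [O.zero_mem]⟩
  mul_mem' := by
    rintro x y ⟨k, hk⟩ ⟨l, hl⟩
    refine ⟨k + l, ?_⟩
    rw [pow_add, ← smul_mul_smul_comm]
    exact O.mul_mem hk hl
  add_mem' := by
    rintro x y ⟨k, hk⟩ ⟨l, hl⟩
    refine ⟨k + l, ?_⟩
    rw [smul_add]
    refine O.add_mem ?_ ?_
    · rw [pow_add, mul_comm, mul_smul]
      exact O.nsmul_mem hk _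
    · rw [pow_add, mul_smul]
      exact O.nsmul_mem hl _
  neg_mem' := by
    rintro x ⟨k, hk⟩
    exact ⟨k, by simpa using O.neg_mem hk⟩

end Quaternion

/-! ### The Bruhat-Tits tree of `PGL₂(ℚ_p)` -/

section Tree

variable (p : ℕ) [Fact p.Prime]

/-- The lattices in `ℚ_p²`. -/
def Lattice : Type :=
  {L : Submodule ℤ_[p] (Fin 2 → ℚ_[p]) // Submodule.IsLattice ℚ_[p] L}

variable {p}

/-- The `ℤ_p`-linear map `v ↦ A v` of `ℚ_p²` (column vectors). -/
def mulVecZp (A : Matrix (Fin 2) (Fin 2) ℚ_[p]) : (Fin 2 → ℚ_[p]) →ₗ[ℤ_[p]] (Fin 2 → ℚ_[p]) :=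
  (Matrix.mulVecLin A).restrictScalars ℤ_[p]

theorem mulVecZp_apply (A : Matrix (Fin 2) (Fin 2) ℚ_[p]) (v : Fin 2 → ℚ_[p]) :
    mulVecZp A v = A.mulVec v := rfl

theorem mulVecZp_one : mulVecZp (1 : Matrix (Fin 2) (Fin 2) ℚ_[p]) = LinearMap.id := by
  refine LinearMap.ext fun v => ?_
  rw [mulVecZp_apply, Matrix.one_mulVec, LinearMap.id_apply]

theorem mulVecZp_mul (A B : Matrix (Fin 2) (Fin 2) ℚ_[p]) :
    mulVecZp (A * B) = (mulVecZp A).comp (mulVecZp B) := by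
  refine LinearMap.ext fun v => ?_
  rw [LinearMap.comp_apply, mulVecZp_apply, mulVecZp_apply, mulVecZp_apply, Matrix.mulVec_mulVec]

theorem mulVecZp_injective (A : GL (Fin 2) ℚ_[p]) :
    Function.Injective (mulVecZp (A : Matrix (Fin 2) (Fin 2) ℚ_[p])) := by
  refine Function.LeftInverse.injective
    (g := mulVecZp ((A⁻¹ : GL (Fin 2) ℚ_[p]) : Matrix (Fin 2) (Fin 2) ℚ_[p])) fun v => ?_
  rw [← LinearMap.comp_apply, ← mulVecZp_mul, ← Units.val_mul, inv_mul_cancel, Units.val_one,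
    mulVecZp_one, LinearMap.id_apply]

theorem isLattice_map (A : GL (Fin 2) ℚ_[p]) {L : Submodule ℤ_[p] (Fin 2 → ℚ_[p])}
    (hL : Submodule.IsLattice ℚ_[p] L) :
    Submodule.IsLattice ℚ_[p] (L.map (mulVecZp (A : Matrix (Fin 2) (Fin 2) ℚ_[p]))) where
  fg := hL.fg.map _
  span_eq_top := by
    have h : ((L.map (mulVecZp (A : Matrix (Fin 2) (Fin 2) ℚ_[p])) :
        Submodule ℤ_[p] (Fin 2 → ℚ_[p])) : Set (Fin 2 → ℚ_[p])) =
        Matrix.mulVecLin (A : Matrix (Fin 2) (Fin 2) ℚ_[p]) '' (L : Set (Fin 2 → ℚ_[p])) := rfl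
    rw [h, Submodule.span_image, hL.span_eq_top, Submodule.map_top, LinearMap.range_eq_top]
    intro v
    refine ⟨((A⁻¹ : GL (Fin 2) ℚ_[p]) : Matrix (Fin 2) (Fin 2) ℚ_[p]).mulVec v, ?_⟩
    rw [Matrix.mulVecLin_apply, Matrix.mulVec_mulVec, ← Units.val_mul, mul_inv_cancel,
      Units.val_one, Matrix.one_mulVec]

/-- The action of `GL₂(ℚ_p)` on lattices. -/
instance : MulAction (GL (Fin 2) ℚ_[p]) (Lattice p) where
  smul A L := ⟨L.1.map (mulVecZp (A : Matrix (Fin 2) (Fin 2) ℚ_[p])), isLattice_map A L.2⟩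
  one_smul L := Subtype.ext (by
    change L.1.map (mulVecZp ((1 : GL (Fin 2) ℚ_[p]) : Matrix (Fin 2) (Fin 2) ℚ_[p])) = L.1
    rw [Units.val_one, mulVecZp_one, Submodule.map_id])
  mul_smul A B L := Subtype.ext (by
    change L.1.map (mulVecZp ((A * B : GL (Fin 2) ℚ_[p]) : Matrix (Fin 2) (Fin 2) ℚ_[p])) =
      (L.1.map (mulVecZp (B : Matrix (Fin 2) (Fin 2) ℚ_[p]))).map
        (mulVecZp (A : Matrix (Fin 2) (Fin 2) ℚ_[p]))
    rw [Units.val_mul, mulVecZp_mul, Submodule.map_comp])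

theorem lattice_smul_val (A : GL (Fin 2) ℚ_[p]) (L : Lattice p) :
    (A • L).1 = L.1.map (mulVecZp (A : Matrix (Fin 2) (Fin 2) ℚ_[p])) := rfl

/-- Homothety of lattices: `L' = c L` for some `c ∈ ℚ_pˣ`. -/
instance homothety (p : ℕ) [Fact p.Prime] : Setoid (Lattice p) where
  r L L' := ∃ c : ℚ_[p]ˣ, L'.1 = c • L.1
  iseqv :=
    { refl := fun L => ⟨1, (one_smul _ _).symm⟩
      symm := by
        rintro L L' ⟨c, hc⟩
        exact ⟨c⁻¹, by rw [hc, inv_smul_smul]⟩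
      trans := by
        rintro L L' L'' ⟨c, hc⟩ ⟨d, hd⟩
        exact ⟨d * c, by rw [hd, hc, mul_smul]⟩ }

theorem map_units_smul (A : Matrix (Fin 2) (Fin 2) ℚ_[p]) (c : ℚ_[p]ˣ)
    (L : Submodule ℤ_[p] (Fin 2 → ℚ_[p])) :
    (c • L).map (mulVecZp A) = c • L.map (mulVecZp A) := by
  have key : ∀ x : Fin 2 → ℚ_[p], mulVecZp A (c • x) = c • mulVecZp A x := fun x => by
    rw [mulVecZp_apply, mulVecZp_apply, Units.smul_def, Units.smul_def, Matrix.mulVec_smul]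
  ext v
  constructor
  · rintro ⟨w, ⟨x, hx, rfl⟩, rfl⟩
    exact ⟨mulVecZp A x, ⟨x, hx, rfl⟩, (key x).symm⟩
  · rintro ⟨w, ⟨x, hx, rfl⟩, rfl⟩
    exact ⟨c • x, ⟨x, hx, rfl⟩, key x⟩

variable (p) in
/-- The vertices of the tree: homothety classes of lattices. -/
def Vertex : Type := Quotient (homothety p)

/-- The class of a lattice. -/
def Vertex.mk (L : Lattice p) : Vertex p := Quotient.mk (homothety p) L

/-- The action of `GL₂(ℚ_p)` on vertices. -/
instance : MulAction (GL (Fin 2) ℚ_[p]) (Vertex p) where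
  smul A := Quotient.map (fun L => A • L) (by
    rintro L L' ⟨c, hc⟩
    exact ⟨c, by rw [lattice_smul_val, lattice_smul_val, hc, map_units_smul]⟩)
  one_smul v := Quotient.inductionOn v fun L => congrArg Vertex.mk (one_smul _ L)
  mul_smul A B v := Quotient.inductionOn v fun L => congrArg Vertex.mk (mul_smul A B L)

theorem smul_mk (A : GL (Fin 2) ℚ_[p]) (L : Lattice p) : A • Vertex.mk L = Vertex.mk (A • L) :=
  rfl

variable (p) in
/-- The scalar `p` as a unit of `ℚ_p`. -/
def primeUnit : ℚ_[p]ˣ := Units.mk0 (p : ℚ_[p]) (by exact_mod_cast (Fact.out : p.Prime).ne_zero)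

theorem units_smul_mono (c : ℚ_[p]ˣ) {L L' : Submodule ℤ_[p] (Fin 2 → ℚ_[p])} :
    c • L < c • L' ↔ L < L' := by
  have h : ∀ (d : ℚ_[p]ˣ) {K K' : Submodule ℤ_[p] (Fin 2 → ℚ_[p])}, K ≤ K' → d • K ≤ d • K' := by
    rintro d K K' hK _ ⟨x, hx, rfl⟩
    exact ⟨x, hK hx, rfl⟩
  have h' : ∀ {K K' : Submodule ℤ_[p] (Fin 2 → ℚ_[p])}, c • K ≤ c • K' ↔ K ≤ K' := by
    intro K K'
    refine ⟨fun hK => ?_, h c⟩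
    simpa using h c⁻¹ hK
  rw [lt_iff_le_not_ge, lt_iff_le_not_ge, h', h']

theorem units_smul_le {c : ℚ_[p]ˣ} (hc : ‖(c : ℚ_[p])‖ ≤ 1)
    (L : Submodule ℤ_[p] (Fin 2 → ℚ_[p])) : c • L ≤ L := by
  rintro _ ⟨x, hx, rfl⟩
  exact L.smul_mem (⟨(c : ℚ_[p]), hc⟩ : ℤ_[p]) hx

variable (p) in
/-- The Bruhat-Tits tree: two vertices are adjacent if they can be represented by lattices
`L₁`, `L₂` with `p L₁ ⊊ L₂ ⊊ L₁`. -/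
def tree : SimpleGraph (Vertex p) where
  Adj v w := ∃ L₁ L₂ : Lattice p, v = Vertex.mk L₁ ∧ w = Vertex.mk L₂ ∧
    primeUnit p • L₁.1 < L₂.1 ∧ L₂.1 < L₁.1
  symm := ⟨by
    rintro v w ⟨L₁, L₂, rfl, rfl, h₁, h₂⟩
    refine ⟨L₂, ⟨primeUnit p • L₁.1, ?_⟩, rfl, Quotient.sound ⟨primeUnit p, rfl⟩, ?_, h₁⟩
    · have := L₁.2
      exact Submodule.IsLattice.smul ℚ_[p] L₁.1 (primeUnit p)
    · exact (units_smul_mono _).2 h₂⟩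
  loopless := ⟨by
    rintro v ⟨L₁, L₂, h, h', h₁, h₂⟩
    obtain ⟨c, hc⟩ : ∃ c : ℚ_[p]ˣ, L₂.1 = c • L₁.1 := Quotient.exact (h.symm.trans h')
    rw [hc] at h₁ h₂
    rcases lt_or_ge ‖(c : ℚ_[p])‖ 1 with hlt | hge
    · have hle : ‖((primeUnit p)⁻¹ * c : ℚ_[p]ˣ).val‖ ≤ 1 := by
        have h3 : ‖(c : ℚ_[p])‖ ≤ (p : ℝ)⁻¹ := by
          have := (Padic.norm_le_pow_iff_norm_lt_pow_add_one (c : ℚ_[p]) (-1)).2 (by simpa using hlt)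
          simpa using this
        have hp : (0 : ℝ) < p := by exact_mod_cast (Fact.out : p.Prime).pos
        rw [Units.val_mul, norm_mul, Units.val_inv_eq_inv_val, norm_inv]
        simp only [primeUnit, Units.val_mk0, Padic.norm_p, inv_inv]
        calc (p : ℝ) * ‖(c : ℚ_[p])‖ ≤ p * (p : ℝ)⁻¹ := by gcongr
          _ = 1 := mul_inv_cancel₀ hp.ne'
      have h4 := units_smul_le hle L₁.1
      have h5 : c • L₁.1 ≤ primeUnit p • L₁.1 := by
        rintro _ ⟨x, hx, rfl⟩
        refine ⟨((primeUnit p)⁻¹ * c) • x, h4 ⟨x, hx, rfl⟩, ?_⟩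
        change primeUnit p • ((primeUnit p)⁻¹ * c) • x = c • x
        rw [smul_smul, mul_inv_cancel_left]
      exact h₁.not_ge h5
    · have h4 : c⁻¹ • (c • L₁.1) ≤ c • L₁.1 := units_smul_le (by
        rw [Units.val_inv_eq_inv_val, norm_inv]; exact inv_le_one_of_one_le₀ hge) _
      rw [inv_smul_smul] at h4
      exact h₂.not_ge h4⟩

variable (p) in
/-- The directed edges of the tree; `e.fst` is the source, `e.snd` the target and `e.symm` the
opposite of the edge `e`. -/
abbrev Edge : Type := (tree p).Dart

theorem smul_adj (A : GL (Fin 2) ℚ_[p]) {v w : Vertex p} (h : (tree p).Adj v w) :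
    (tree p).Adj (A • v) (A • w) := by
  have hlt : ∀ {K K' : Submodule ℤ_[p] (Fin 2 → ℚ_[p])}, K < K' →
      K.map (mulVecZp (A : Matrix (Fin 2) (Fin 2) ℚ_[p])) <
        K'.map (mulVecZp (A : Matrix (Fin 2) (Fin 2) ℚ_[p])) := by
    intro K K' hK
    exact Submodule.map_strictMono_of_injective (mulVecZp_injective A) hK
  obtain ⟨L₁, L₂, rfl, rfl, h₁, h₂⟩ := h
  refine ⟨A • L₁, A • L₂, rfl, rfl, ?_, hlt h₂⟩
  rw [lattice_smul_val, ← map_units_smul]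
  exact hlt h₁

/-- The action of `GL₂(ℚ_p)` on directed edges. -/
instance : SMul (GL (Fin 2) ℚ_[p]) (Edge p) where
  smul A e := ⟨(A • e.fst, A • e.snd), smul_adj A e.adj⟩

variable (p) in
/-- The lattice `ℤ_p ⊕ ℤ_p`. -/
def stdLattice : Lattice p :=
  ⟨{ carrier := {v | ‖v 0‖ ≤ 1 ∧ ‖v 1‖ ≤ 1}
     zero_mem' := by simp
     add_mem' := by
       rintro v w ⟨h0, h1⟩ ⟨h0', h1'⟩
       exact ⟨(Padic.nonarchimedean _ _).trans (max_le h0 h0'),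
         (Padic.nonarchimedean _ _).trans (max_le h1 h1')⟩
     smul_mem' := by
       rintro c v ⟨h0, h1⟩
       have hc : ‖(c : ℚ_[p])‖ ≤ 1 := c.2
       refine ⟨?_, ?_⟩
       · change ‖(c : ℚ_[p]) * v 0‖ ≤ 1
         rw [norm_mul]; exact mul_le_one₀ hc (norm_nonneg _) h0
       · change ‖(c : ℚ_[p]) * v 1‖ ≤ 1
         rw [norm_mul]; exact mul_le_one₀ hc (norm_nonneg _) h1 }, by
    refine ⟨Submodule.fg_def.2 ⟨({![1, 0], ![0, 1]} : Set (Fin 2 → ℚ_[p])), Set.toFinite _, ?_⟩,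
      ?_⟩
    · apply le_antisymm
      · rw [Submodule.span_le]
        intro v hv
        rcases hv with rfl | rfl
        · change ‖(1 : ℚ_[p])‖ ≤ 1 ∧ ‖(0 : ℚ_[p])‖ ≤ 1
          simp
        · change ‖(0 : ℚ_[p])‖ ≤ 1 ∧ ‖(1 : ℚ_[p])‖ ≤ 1
          simp
      · rintro v ⟨h0, h1⟩
        let c₀ : ℤ_[p] := ⟨v 0, h0⟩
        let c₁ : ℤ_[p] := ⟨v 1, h1⟩
        have hv : v = c₀ • (![1, 0] : Fin 2 → ℚ_[p]) + c₁ • (![0, 1] : Fin 2 → ℚ_[p]) := by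
          ext i
          fin_cases i
          · change v 0 = v 0 * 1 + v 1 * 0
            ring
          · change v 1 = v 0 * 0 + v 1 * 1
            ring
        rw [hv]
        exact Submodule.add_mem _
          (Submodule.smul_mem _ _ (Submodule.subset_span (by simp)))
          (Submodule.smul_mem _ _ (Submodule.subset_span (by simp)))
    · rw [eq_top_iff]
      rintro v -
      have hv : v = v 0 • (![1, 0] : Fin 2 → ℚ_[p]) + v 1 • (![0, 1] : Fin 2 → ℚ_[p]) := by
        ext i
        fin_cases i <;> simp
      rw [hv]
      refine Submodule.add_mem _ (Submodule.smul_mem _ _ (Submodule.subset_span ?_))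
        (Submodule.smul_mem _ _ (Submodule.subset_span ?_))
      · change ‖(1 : ℚ_[p])‖ ≤ 1 ∧ ‖(0 : ℚ_[p])‖ ≤ 1
        simp
      · change ‖(0 : ℚ_[p])‖ ≤ 1 ∧ ‖(1 : ℚ_[p])‖ ≤ 1
        simp⟩

theorem mem_stdLattice (v : Fin 2 → ℚ_[p]) :
    v ∈ (stdLattice p).1 ↔ ‖v 0‖ ≤ 1 ∧ ‖v 1‖ ≤ 1 := Iff.rfl

variable (p) in
/-- The diagonal matrix `diag(1, p)`. -/
def diagP : GL (Fin 2) ℚ_[p] :=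
  Matrix.GeneralLinearGroup.mkOfDetNeZero !![1, 0; 0, (p : ℚ_[p])] (by
    simpa [Matrix.det_fin_two] using (Fact.out : p.Prime).ne_zero)

variable (p) in
/-- The lattice `ℤ_p ⊕ p ℤ_p`. -/
def stdLatticeHat : Lattice p := diagP p • stdLattice p

theorem mem_stdLatticeHat (v : Fin 2 → ℚ_[p]) :
    v ∈ (stdLatticeHat p).1 ↔ ‖v 0‖ ≤ 1 ∧ ‖v 1‖ ≤ (p : ℝ)⁻¹ := by
  have hp : (0 : ℝ) < p := by exact_mod_cast (Fact.out : p.Prime).pos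
  have hp' : (p : ℚ_[p]) ≠ 0 := by exact_mod_cast (Fact.out : p.Prime).ne_zero
  constructor
  · rintro ⟨w, ⟨h0, h1⟩, rfl⟩
    change ‖(Matrix.mulVec !![1, 0; 0, (p : ℚ_[p])] w) 0‖ ≤ 1 ∧
      ‖(Matrix.mulVec !![1, 0; 0, (p : ℚ_[p])] w) 1‖ ≤ (p : ℝ)⁻¹
    simp only [Matrix.mulVec_fin_two, Matrix.of_apply, Matrix.cons_val', Matrix.cons_val_zero,
      Matrix.cons_val_one, Matrix.cons_val_fin_one, one_mul, zero_mul, add_zero, zero_add,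
      norm_mul, Padic.norm_p]
    exact ⟨h0, mul_le_of_le_one_right (by positivity) h1⟩
  · rintro ⟨h0, h1⟩
    refine ⟨![v 0, (p : ℚ_[p])⁻¹ * v 1], ⟨h0, ?_⟩, ?_⟩
    · change ‖(p : ℚ_[p])⁻¹ * v 1‖ ≤ 1
      rw [norm_mul, norm_inv, Padic.norm_p, inv_inv]
      calc (p : ℝ) * ‖v 1‖ ≤ p * (p : ℝ)⁻¹ := by gcongr
        _ = 1 := mul_inv_cancel₀ hp.ne'
    · change Matrix.mulVec !![1, 0; 0, (p : ℚ_[p])] ![v 0, (p : ℚ_[p])⁻¹ * v 1] = v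
      ext i
      fin_cases i
      · simp
      · simp [mul_comm _ (p : ℚ_[p]), mul_inv_cancel_left₀ hp']

variable (p) in
/-- The vertex `v_*`, the class of `ℤ_p ⊕ ℤ_p`. -/
def vStar : Vertex p := Vertex.mk (stdLattice p)

variable (p) in
/-- The vertex `v̂_*`, the class of `ℤ_p ⊕ p ℤ_p`. -/
def vHat : Vertex p := Vertex.mk (stdLatticeHat p)

theorem vStar_adj_vHat : (tree p).Adj (vStar p) (vHat p) := by
  have hp : (1 : ℝ) < p := by exact_mod_cast (Fact.out : p.Prime).one_lt
  have hinv : (p : ℝ)⁻¹ < 1 := inv_lt_one_of_one_lt₀ hp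
  refine ⟨stdLattice p, stdLatticeHat p, rfl, rfl, ?_, ?_⟩
  · rw [SetLike.lt_iff_le_and_exists]
    have hsm : ∀ (x : Fin 2 → ℚ_[p]) (i : Fin 2), x i = x i → ‖x i‖ ≤ 1 →
        ‖(primeUnit p • x) i‖ ≤ (p : ℝ)⁻¹ := by
      intro x i _ h
      change ‖(p : ℚ_[p]) * x i‖ ≤ _
      rw [norm_mul, Padic.norm_p]
      exact mul_le_of_le_one_right (by positivity) h
    refine ⟨?_, ![1, 0], ?_, ?_⟩
    · rintro _ ⟨x, ⟨h0, h1⟩, rfl⟩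
      exact (mem_stdLatticeHat _).2 ⟨(hsm x 0 rfl h0).trans hinv.le, hsm x 1 rfl h1⟩
    · refine (mem_stdLatticeHat _).2 ⟨?_, ?_⟩ <;> simp
    · rintro ⟨x, ⟨h0, h1⟩, hx⟩
      have h2 := hsm x 0 rfl h0
      have h3 : (primeUnit p • x) 0 = 1 := congrFun hx 0
      rw [h3, norm_one] at h2
      exact absurd h2 (not_le.2 hinv)
  · rw [SetLike.lt_iff_le_and_exists]
    refine ⟨fun v hv => ?_, ![0, 1], ?_, ?_⟩
    · have h := (mem_stdLatticeHat _).1 hv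
      exact ⟨h.1, h.2.trans hinv.le⟩
    · refine (mem_stdLattice _).2 ⟨?_, ?_⟩ <;> simp
    · intro h
      have h2 := ((mem_stdLatticeHat _).1 h).2
      simp only [Matrix.cons_val_one, Matrix.cons_val_fin_one, norm_one] at h2
      exact absurd h2 (not_le.2 hinv)

variable (p) in
/-- The edge `e_* = (v_*, v̂_*)`. -/
def eStar : Edge p := ⟨(vStar p, vHat p), vStar_adj_vHat⟩

/-- A vertex is even if its distance to `v_*` is even. -/
def Vertex.IsEven (v : Vertex p) : Prop := Even ((tree p).dist v (vStar p))

/-- An edge is even if its source is. -/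
def EvenEdge (e : Edge p) : Prop := Vertex.IsEven e.fst

/-- An edge is inward if its target is closer to `v_*` than its source. -/
def Inward (e : Edge p) : Prop :=
  (tree p).dist e.snd (vStar p) < (tree p).dist e.fst (vStar p)

/-- An edge is outward if its source is closer to `v_*` than its target. -/
def Outward (e : Edge p) : Prop :=
  (tree p).dist e.fst (vStar p) < (tree p).dist e.snd (vStar p)

end Tree

/-! ### Balls and measures on `ℙ¹(ℚ_p) = ℚ_p ∪ {∞}` -/

section Measure

variable (p : ℕ) [Fact p.Prime]

/-- `ℤ_p` as a subset of `ℙ¹(ℚ_p)`. -/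
def zpBall : Set (OnePoint ℚ_[p]) := (fun x : ℚ_[p] => (x : OnePoint ℚ_[p])) '' {x | ‖x‖ ≤ 1}

variable {p} in
open scoped Classical in
/-- The ball `U_e`: the correspondence `e ↦ U_e` is the `GL₂(ℚ_p)`-equivariant one with
`U_{e_*} = ℤ_p`, so that `U_e = A ℤ_p` whenever `e = A e_*`; here `GL₂(ℚ_p)` acts on `ℙ¹(ℚ_p)` by
fractional linear transformations. -/
def ball (e : Edge p) : Set (OnePoint ℚ_[p]) :=
  {x | ∃ A : GL (Fin 2) ℚ_[p], A • eStar p = e ∧ ∃ t ∈ zpBall p, x = A • t}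

/-- The `ℤ`-valued (finitely additive) measures on `ℙ¹(ℚ_p)` of total measure `0`. -/
structure Meas₀ where
  /-- The value on a compact open subset. -/
  val : TopologicalSpace.CompactOpens (OnePoint ℚ_[p]) → ℤ
  additive : ∀ U V : TopologicalSpace.CompactOpens (OnePoint ℚ_[p]),
    Disjoint (U : Set (OnePoint ℚ_[p])) V → val (U ⊔ V) = val U + val V
  total : val ⊤ = 0

variable {p} in
/-- The measure `m` corresponds to the function `c` on edges under `m(U_e) = c(e)`. -/
def Corresponds (m : Meas₀ p) (c : Edge p → ℤ) : Prop :=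
  ∀ (e : Edge p) (U : TopologicalSpace.CompactOpens (OnePoint ℚ_[p])),
    (U : Set (OnePoint ℚ_[p])) = ball e → m.val U = c e

end Measure

/-! ### The arithmetic groups, the radial system and `μ` -/

section Arithmetic

variable {p : ℕ} [Fact p.Prime] {a b : ℚ}

/-- The ring homomorphism `B → M₂(ℚ_p)` given by an isomorphism `B ⊗ ℚ_p ≃ M₂(ℚ_p)`. -/
def loc (ι : ℚ_[p] ⊗[ℚ] ℍ[ℚ,a,b] ≃ₐ[ℚ_[p]] Matrix (Fin 2) (Fin 2) ℚ_[p]) :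
    ℍ[ℚ,a,b] →+* Matrix (Fin 2) (Fin 2) ℚ_[p] :=
  (ι : ℚ_[p] ⊗[ℚ] ℍ[ℚ,a,b] →+* Matrix (Fin 2) (Fin 2) ℚ_[p]).comp
    (Algebra.TensorProduct.includeRight : ℍ[ℚ,a,b] →ₐ[ℚ] ℚ_[p] ⊗[ℚ] ℍ[ℚ,a,b]).toRingHom

/-- The homomorphism `Bˣ → GL₂(ℚ_p)`. -/
def locGL (ι : ℚ_[p] ⊗[ℚ] ℍ[ℚ,a,b] ≃ₐ[ℚ_[p]] Matrix (Fin 2) (Fin 2) ℚ_[p]) :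
    (ℍ[ℚ,a,b])ˣ →* GL (Fin 2) ℚ_[p] :=
  Units.map (loc ι).toMonoidHom

variable (p) in
/-- The order of matrices in `M₂(ℤ_p)` with lower left entry divisible by `p`. -/
def iwahoriOrder : Subring (Matrix (Fin 2) (Fin 2) ℚ_[p]) where
  carrier := {A | (∀ i j, ‖A i j‖ ≤ 1) ∧ ‖A 1 0‖ < 1}
  one_mem' := by
    refine ⟨fun i j => ?_, by simp⟩
    fin_cases i <;> fin_cases j <;> simp
  zero_mem' := by simp
  add_mem' := by
    rintro A B ⟨hA, hA'⟩ ⟨hB, hB'⟩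
    exact ⟨fun i j => (Padic.nonarchimedean _ _).trans (max_le (hA i j) (hB i j)),
      (Padic.nonarchimedean _ _).trans_lt (max_lt hA' hB')⟩
  neg_mem' := by
    rintro A ⟨hA, hA'⟩
    exact ⟨fun i j => by simpa using hA i j, by simpa using hA'⟩
  mul_mem' := by
    rintro A B ⟨hA, hA'⟩ ⟨hB, hB'⟩
    refine ⟨fun i j => ?_, ?_⟩
    · rw [Matrix.mul_apply, Fin.sum_univ_two]
      refine (Padic.nonarchimedean _ _).trans (max_le ?_ ?_) <;> rw [norm_mul]
      · exact mul_le_one₀ (hA _ _) (norm_nonneg _) (hB _ _)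
      · exact mul_le_one₀ (hA _ _) (norm_nonneg _) (hB _ _)
    · rw [Matrix.mul_apply, Fin.sum_univ_two]
      refine (Padic.nonarchimedean _ _).trans_lt (max_lt ?_ ?_) <;> rw [norm_mul]
      · exact mul_lt_one_of_nonneg_of_lt_one_left (norm_nonneg _) hA' (hB _ _)
      · exact mul_lt_one_of_nonneg_of_lt_one_right (hA _ _) (norm_nonneg _) hB'

variable (p) in
/-- `Γ₀^loc(p)`: the matrices in `SL₂(ℤ_p)` with lower left entry divisible by `p`. -/
def gammaLoc : Set (Matrix (Fin 2) (Fin 2) ℚ_[p]) :=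
  {A | A ∈ iwahoriOrder p ∧ A.det = 1}

/-- `ι_p(O ⊗ ℤ_p) = M₂(ℤ_p)`. -/
def IsStandardAt (ι : ℚ_[p] ⊗[ℚ] ℍ[ℚ,a,b] ≃ₐ[ℚ_[p]] Matrix (Fin 2) (Fin 2) ℚ_[p])
    (O : Subring ℍ[ℚ,a,b]) : Prop :=
  (Submodule.span ℤ_[p] (loc ι '' (O : Set ℍ[ℚ,a,b])) : Set (Matrix (Fin 2) (Fin 2) ℚ_[p])) =
    {A | ∀ i j, ‖A i j‖ ≤ 1}

/-- For `O = R₀(M)`, the Eichler order `R₀(pM)`: it is equal to `R₀(M)` away from `p`, and at `p` it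
consists of the matrices that are upper triangular modulo `p`. -/
def levelP (ι : ℚ_[p] ⊗[ℚ] ℍ[ℚ,a,b] ≃ₐ[ℚ_[p]] Matrix (Fin 2) (Fin 2) ℚ_[p])
    (O : Subring ℍ[ℚ,a,b]) : Subring ℍ[ℚ,a,b] :=
  O ⊓ (iwahoriOrder p).comap (loc ι)

/-- The group `Γ₀ᴰ(pM) = R₀(pM)₁ˣ`. -/
def gammaPM (ι : ℚ_[p] ⊗[ℚ] ℍ[ℚ,a,b] ≃ₐ[ℚ_[p]] Matrix (Fin 2) (Fin 2) ℚ_[p])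
    (O : Subring ℍ[ℚ,a,b]) : Subgroup (ℍ[ℚ,a,b])ˣ :=
  normOneUnits (levelP ι O)

variable (p) in
/-- The group `Γ = R₁ˣ` with `R = R₀(M)[1/p]`. -/
def bigGamma (O : Subring ℍ[ℚ,a,b]) : Subgroup (ℍ[ℚ,a,b])ˣ :=
  normOneUnits (invertP p O)

/-- `γ₀ = 1, γ₁, …, γ_p` is a system of representatives for `Γ₀ᴰ(pM) \ Γ₀ᴰ(M)` such that, for
`i > 0`, `ι_p(γ_i) = u_i (0 -1; 1 i)` with `u_i ∈ Γ₀^loc(p)`. -/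
structure IsUpsilon (ι : ℚ_[p] ⊗[ℚ] ℍ[ℚ,a,b] ≃ₐ[ℚ_[p]] Matrix (Fin 2) (Fin 2) ℚ_[p])
    (O : Subring ℍ[ℚ,a,b]) (γ : Fin (p + 1) → (ℍ[ℚ,a,b])ˣ) : Prop where
  mem : ∀ i, γ i ∈ normOneUnits O
  representatives : ∀ x ∈ normOneUnits O, ∃! i, x * (γ i)⁻¹ ∈ gammaPM ι O
  zero : γ 0 = 1
  local_form : ∀ i, i ≠ 0 → ∃ u ∈ gammaLoc p,
    loc ι (γ i) = u * !![0, -1; 1, ((i : ℕ) : ℚ_[p])]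

/-- `ω_p` is an element of `R₀(pM)` that normalizes `Γ₀ᴰ(pM)` and such that
`ι_p(ω_p) = u' (0 -1; p 0)` with `u' ∈ Γ₀^loc(p)`. -/
structure IsOmega (ι : ℚ_[p] ⊗[ℚ] ℍ[ℚ,a,b] ≃ₐ[ℚ_[p]] Matrix (Fin 2) (Fin 2) ℚ_[p])
    (O : Subring ℍ[ℚ,a,b]) (ω : (ℍ[ℚ,a,b])ˣ) : Prop where
  mem : (ω : ℍ[ℚ,a,b]) ∈ levelP ι O
  normalizes : ∀ x, x ∈ gammaPM ι O ↔ ω * x * ω⁻¹ ∈ gammaPM ι O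
  local_form : ∃ u ∈ gammaLoc p, loc ι ω = u * !![0, -1; (p : ℚ_[p]), 0]

variable (p) (a) (b) in
/-- The scalar `p` as a unit of `B`. -/
def scalarP : (ℍ[ℚ,a,b])ˣ :=
  Units.map (algebraMap ℚ ℍ[ℚ,a,b]).toMonoidHom
    (Units.mk0 (p : ℚ) (by exact_mod_cast (Fact.out : p.Prime).ne_zero))

/-- `γ̃₀ = 1` and `γ̃_i = p⁻¹ ω_p γ_i ω_p` for `i > 0`. -/
def tildeGamma (ω : (ℍ[ℚ,a,b])ˣ) (γ : Fin (p + 1) → (ℍ[ℚ,a,b])ˣ) (i : Fin (p + 1)) :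
    (ℍ[ℚ,a,b])ˣ :=
  if i = 0 then 1 else (scalarP p a b)⁻¹ * ω * γ i * ω

/-- The radial system `{γ_e}`, `{γ_v}` attached to `{γ_i}` and `{γ̃_i}`. Only the values of `γE` at
even edges matter: there `γ_e` represents the coset in `Γ₀ᴰ(pM) \ Γ` that corresponds to `e`, that
is `γ_e⁻¹ e_* = e`. -/
structure IsRadialSystem (ι : ℚ_[p] ⊗[ℚ] ℍ[ℚ,a,b] ≃ₐ[ℚ_[p]] Matrix (Fin 2) (Fin 2) ℚ_[p])
    (O : Subring ℍ[ℚ,a,b]) (ω : (ℍ[ℚ,a,b])ˣ) (γ : Fin (p + 1) → (ℍ[ℚ,a,b])ˣ)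
    (γE : Edge p → (ℍ[ℚ,a,b])ˣ) (γV : Vertex p → (ℍ[ℚ,a,b])ˣ) : Prop where
  memE : ∀ e, EvenEdge e → γE e ∈ bigGamma p O
  representsE : ∀ e, EvenEdge e → locGL ι (γE e)⁻¹ • eStar p = e
  memV : ∀ v, γV v ∈ bigGamma p O
  representsV_even : ∀ v, v.IsEven → locGL ι (γV v)⁻¹ • vStar p = v
  representsV_odd : ∀ v, ¬ v.IsEven → locGL ι (γV v)⁻¹ • vHat p = v
  vStar_eq : γV (vStar p) = 1
  vHat_eq : γV (vHat p) = 1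
  source_eq : ∀ v : Vertex p, v.IsEven →
    γE '' {e | e.fst = v} = Set.range fun i => γ i * γV v
  target_eq : ∀ v : Vertex p, ¬ v.IsEven →
    γE '' {e | e.snd = v} = Set.range fun i => tildeGamma ω γ i * γV v
  inward_eq : ∀ e, EvenEdge e → Inward e → γV e.fst = γE e
  outward_eq : ∀ e, EvenEdge e → Outward e → γV e.snd = γE e

/-- The element `h(g, e)` with `γ_e g = h(g, e) γ_{g⁻¹ e}`. -/
def hElt (ι : ℚ_[p] ⊗[ℚ] ℍ[ℚ,a,b] ≃ₐ[ℚ_[p]] Matrix (Fin 2) (Fin 2) ℚ_[p])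
    (γE : Edge p → (ℍ[ℚ,a,b])ˣ) (g : (ℍ[ℚ,a,b])ˣ) (e : Edge p) : (ℍ[ℚ,a,b])ˣ :=
  γE e * g * (γE (locGL ι g⁻¹ • e))⁻¹

open scoped Classical in
/-- The function `μ_g` on edges: `μ_g(e) = φ(h(g, e))` if `e` is even and `μ_g(e) = -μ_g(ē)` if `e`
is odd. For `g ∈ Γ` and a radial system, `h(g, e)` always lies in `Γ₀ᴰ(pM)`, so that the default
value `0` is never used. -/
def mu (ι : ℚ_[p] ⊗[ℚ] ℍ[ℚ,a,b] ≃ₐ[ℚ_[p]] Matrix (Fin 2) (Fin 2) ℚ_[p])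
    (O : Subring ℍ[ℚ,a,b]) (γE : Edge p → (ℍ[ℚ,a,b])ˣ) (φ : gammaPM ι O → ℤ)
    (g : (ℍ[ℚ,a,b])ˣ) (e : Edge p) : ℤ :=
  let φ' : (ℍ[ℚ,a,b])ˣ → ℤ := fun x => if hx : x ∈ gammaPM ι O then φ ⟨x, hx⟩ else 0
  if EvenEdge e then φ' (hElt ι γE g e) else - φ' (hElt ι γE g e.symm)

/-- The alternating product along a list of indices; `γ̃_{i₁} γ_{i₂} γ̃_{i₃} ⋯` if `tilde` is true,
`γ_{i₁} γ̃_{i₂} γ_{i₃} ⋯` otherwise. -/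
def altProd (ω : (ℍ[ℚ,a,b])ˣ) (γ : Fin (p + 1) → (ℍ[ℚ,a,b])ˣ) :
    Bool → List (Fin (p + 1)) → (ℍ[ℚ,a,b])ˣ
  | _, [] => 1
  | true, i :: l => tildeGamma ω γ i * altProd ω γ false l
  | false, i :: l => γ i * altProd ω γ true l

/-- `x = γ̃_t γ_{i₁} γ̃_{i₂} ⋯`, a finite nonempty alternating product that starts with a `γ̃` and
has all its indices in `{1, …, p}`. -/
def IsInwardWord (ω : (ℍ[ℚ,a,b])ˣ) (γ : Fin (p + 1) → (ℍ[ℚ,a,b])ˣ) (x : (ℍ[ℚ,a,b])ˣ) : Prop :=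
  ∃ l : List (Fin (p + 1)), l ≠ [] ∧ (∀ i ∈ l, i ≠ 0) ∧ x = altProd ω γ true l

end Arithmetic

end DarmonPoints

end

open DarmonPoints

noncomputable section

namespace DarmonPoints

/-! ### Lattices and homothety -/

section Lattices

variable {p : ℕ} [Fact p.Prime]

/-! Since `μ_g(e)` is read off from `h(g, e) = γ_e g γ_{g⁻¹e}⁻¹`, the factor `y` of `g = g₀ y`
cancels as soon as `γ_{e'} y = γ_{y⁻¹e'}`, where `e' = g₀⁻¹e`. The proof consists in showing this
identity for the even edges that matter.

Following the path from `v_*` to an even edge `e`, the radial conditions write `γ_e` as an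
alternating word in the `γ_i`, `γ̃_i` with nonzero indices; the leftmost letter belongs to the part
of the path farthest from `v_*`. Conversely, every such word is some `γ_f`
(`IsRadialSystem.exists_edge_of_word`). For `e ≠ e_*` the rightmost letter is a `γ_i` when the path
does not leave `v_*` through `v̂_*`. In that case appending `y`, which starts with a `γ̃_t`, leaves
the word alternating (`IsRadialSystem.exists_word_mul`), so `γ_e y = γ_f`. Then `f = γ_f⁻¹e_* =
y⁻¹γ_e⁻¹e_* = y⁻¹e` is forced. For `e = e_*` the word of `γ_e` is empty and the same conclusion
holds.

Geometrically, `e_*` points towards `∞` and `U_e` collects the ends on the source side of `e`. So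
`U_e ⊆ ℤ_p` leaves only `e_*` and inward edges outside the part of the tree behind `v̂_*`
(`inward_of_ball_subset`). That region is preserved by `g₀`, which fixes `v_*` and `v̂_*`. The
passage from edges to compact-open sets is the decomposition of such a set into finitely many
disjoint discs `i + pⁿℤ_p`, each of which is a ball `U_e`.

For the existence of the decomposition, `e = g⁻¹e_*` is even because `det ι_p(g) = 1`, and `g γ_e⁻¹`
is an element of `Γ` fixing `e_*`. Such an element is integral at `p` and upper triangular mod `p`,
hence lies in `Γ₀ᴰ(pM)` (`mem_gammaPM_of_smul_eStar`).

All facts about the tree come from one normal form: each vertex is `k [ℤ_p ⊕ pⁿℤ_p]` with `k ∈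
GL₂(ℤ_p)`, and `n` is its distance to `v_*`. Acyclicity enters only through the uniqueness of the
neighbour closer to `v_*`. -/

theorem norm_prime_pos : 0 < ‖(p : ℚ_[p])‖ :=
  norm_pos_iff.2 (by exact_mod_cast (Fact.out : p.Prime).ne_zero)

theorem norm_prime_lt_one : ‖(p : ℚ_[p])‖ < 1 := Padic.norm_p_lt_one

/-- The value group is discrete. This converts strict inequalities, which do not survive the
ultrametric estimates as conveniently, into divisibility by `p`. -/
theorem norm_le_norm_prime {x : ℚ_[p]} (h : ‖x‖ < 1) : ‖x‖ ≤ ‖(p : ℚ_[p])‖ := by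
  have := (Padic.norm_le_pow_iff_norm_lt_pow_add_one x (-1)).2 (by simpa using h)
  simpa using this

theorem norm_add_le_of_le {x y : ℚ_[p]} {r : ℝ} (hx : ‖x‖ ≤ r) (hy : ‖y‖ ≤ r) : ‖x + y‖ ≤ r :=
  (Padic.nonarchimedean _ _).trans (max_le hx hy)

theorem norm_sub_le_of_le {x y : ℚ_[p]} {r : ℝ} (hx : ‖x‖ ≤ r) (hy : ‖y‖ ≤ r) : ‖x - y‖ ≤ r := by
  rw [sub_eq_add_neg]
  exact norm_add_le_of_le hx (by rwa [norm_neg])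

theorem exists_norm_eq_prime_pow {x : ℚ_[p]} (hx : x ≠ 0) (h1 : ‖x‖ ≤ 1) :
    ∃ n : ℕ, ‖x‖ = ‖(p : ℚ_[p]) ^ n‖ := by
  obtain ⟨y, rfl⟩ : ∃ y : ℤ_[p], (y : ℚ_[p]) = x := ⟨⟨x, h1⟩, rfl⟩
  have := PadicInt.norm_eq_zpow_neg_valuation (x := y) (by rintro rfl; simp at hx)
  refine ⟨y.valuation, ?_⟩
  rw [norm_pow, Padic.norm_p, inv_pow, ← zpow_natCast, ← zpow_neg]
  exact this

/-- The scalar matrix `c` in `GL₂(ℚ_p)`. -/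
def scal (c : ℚ_[p]ˣ) : GL (Fin 2) ℚ_[p] := Units.map (algebraMap _ _).toMonoidHom c

theorem scal_val (c : ℚ_[p]ˣ) :
    ((scal c : GL (Fin 2) ℚ_[p]) : Matrix (Fin 2) (Fin 2) ℚ_[p]) = (c : ℚ_[p]) • 1 := by
  change algebraMap ℚ_[p] _ (c : ℚ_[p]) = _
  rw [Algebra.algebraMap_eq_smul_one]

theorem scal_mulVec (c : ℚ_[p]ˣ) (v : Fin 2 → ℚ_[p]) :
    ((scal c : GL (Fin 2) ℚ_[p]) : Matrix (Fin 2) (Fin 2) ℚ_[p]).mulVec v = (c : ℚ_[p]) • v := by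
  rw [scal_val, Matrix.smul_mulVec, Matrix.one_mulVec]

theorem scal_comm (c : ℚ_[p]ˣ) (A : GL (Fin 2) ℚ_[p]) : scal c * A = A * scal c := by
  ext1
  rw [Units.val_mul, Units.val_mul, scal_val]
  simp

theorem norm_det_scal (c : ℚ_[p]ˣ) :
    ‖((scal c : GL (Fin 2) ℚ_[p]) : Matrix (Fin 2) (Fin 2) ℚ_[p]).det‖ = ‖(c : ℚ_[p])‖ ^ 2 := by
  rw [scal_val, Matrix.det_smul]
  simp

theorem scal_smul_val (c : ℚ_[p]ˣ) (L : Lattice p) : (scal c • L).1 = c • L.1 := by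
  ext v
  constructor
  · rintro ⟨w, hw, rfl⟩
    exact ⟨w, hw, (scal_mulVec c w).symm⟩
  · rintro ⟨w, hw, rfl⟩
    exact ⟨w, hw, scal_mulVec c w⟩

theorem mk_eq_mk_iff {L L' : Lattice p} :
    Vertex.mk L = Vertex.mk L' ↔ ∃ c : ℚ_[p]ˣ, L' = scal c • L := by
  constructor
  · intro h
    obtain ⟨c, hc⟩ := Quotient.exact h
    exact ⟨c, Subtype.ext (by rw [hc, scal_smul_val])⟩
  · rintro ⟨c, rfl⟩
    exact Quotient.sound ⟨c, scal_smul_val c L⟩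

theorem mem_smul_lattice (A : GL (Fin 2) ℚ_[p]) (L : Lattice p) (v : Fin 2 → ℚ_[p]) :
    v ∈ (A • L).1 ↔
      ((A⁻¹ : GL (Fin 2) ℚ_[p]) : Matrix (Fin 2) (Fin 2) ℚ_[p]).mulVec v ∈ L.1 := by
  constructor
  · rintro ⟨w, hw, rfl⟩
    rw [mulVecZp_apply, Matrix.mulVec_mulVec, ← Units.val_mul, inv_mul_cancel, Units.val_one,
      Matrix.one_mulVec]
    exact hw
  · intro h
    refine ⟨_, h, ?_⟩
    rw [mulVecZp_apply, Matrix.mulVec_mulVec, ← Units.val_mul, mul_inv_cancel, Units.val_one,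
      Matrix.one_mulVec]

theorem mulVec_mem_smul_lattice (A : GL (Fin 2) ℚ_[p]) {L : Lattice p} {v : Fin 2 → ℚ_[p]}
    (hv : v ∈ L.1) : (A : Matrix (Fin 2) (Fin 2) ℚ_[p]).mulVec v ∈ (A • L).1 :=
  ⟨v, hv, rfl⟩

theorem lattice_smul_le_iff (A : GL (Fin 2) ℚ_[p]) (L L' : Lattice p) :
    (A • L).1 ≤ (A • L').1 ↔ L.1 ≤ L'.1 := by
  rw [lattice_smul_val, lattice_smul_val]
  exact Submodule.map_le_map_iff_of_injective (mulVecZp_injective A) _ _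

theorem lattice_smul_lt_iff (A : GL (Fin 2) ℚ_[p]) (L L' : Lattice p) :
    (A • L).1 < (A • L').1 ↔ L.1 < L'.1 := by
  rw [lt_iff_le_not_ge, lt_iff_le_not_ge, lattice_smul_le_iff, lattice_smul_le_iff]

theorem smul_mem_lattice {L : Lattice p} {c : ℚ_[p]} (hc : ‖c‖ ≤ 1) {v : Fin 2 → ℚ_[p]}
    (hv : v ∈ L.1) : c • v ∈ L.1 :=
  L.1.smul_mem (⟨c, hc⟩ : ℤ_[p]) hv

/-! ### The stabilizer of the standard lattice -/

variable (p) in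
/-- The stabilizer `GL₂(ℤ_p)` of the lattice `ℤ_p ⊕ ℤ_p`. -/
def stdStab : Subgroup (GL (Fin 2) ℚ_[p]) := MulAction.stabilizer _ (stdLattice p)

theorem norm_det_le_one {A : Matrix (Fin 2) (Fin 2) ℚ_[p]} (h : ∀ i j, ‖A i j‖ ≤ 1) :
    ‖A.det‖ ≤ 1 := by
  rw [Matrix.det_fin_two]
  refine norm_sub_le_of_le ?_ ?_ <;> rw [norm_mul] <;>
    exact mul_le_one₀ (h _ _) (norm_nonneg _) (h _ _)

theorem mulVec_mem_stdLattice {A : Matrix (Fin 2) (Fin 2) ℚ_[p]} (h : ∀ i j, ‖A i j‖ ≤ 1)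
    {v : Fin 2 → ℚ_[p]} (hv : v ∈ (stdLattice p).1) : A.mulVec v ∈ (stdLattice p).1 := by
  have key : ∀ i, ‖A.mulVec v i‖ ≤ 1 := fun i => by
    rw [Matrix.mulVec, dotProduct, Fin.sum_univ_two]
    refine norm_add_le_of_le ?_ ?_ <;> rw [norm_mul]
    · exact mul_le_one₀ (h _ _) (norm_nonneg _) hv.1
    · exact mul_le_one₀ (h _ _) (norm_nonneg _) hv.2
  exact ⟨key 0, key 1⟩

theorem norm_entry_le_one_of_smul_le {A : GL (Fin 2) ℚ_[p]}
    (h : (A • stdLattice p).1 ≤ (stdLattice p).1) (i j : Fin 2) :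
    ‖(A : Matrix (Fin 2) (Fin 2) ℚ_[p]) i j‖ ≤ 1 := by
  have hj : Pi.single j (1 : ℚ_[p]) ∈ (stdLattice p).1 := by
    refine (mem_stdLattice _).2 ⟨?_, ?_⟩ <;> fin_cases j <;> simp
  have := (mem_stdLattice _).1 (h (mulVec_mem_smul_lattice A hj))
  rw [Matrix.mulVec_single_one] at this
  fin_cases i
  exacts [this.1, this.2]

theorem inv_entry_norm_le_one {A : GL (Fin 2) ℚ_[p]}
    (h : ∀ i j, ‖(A : Matrix (Fin 2) (Fin 2) ℚ_[p]) i j‖ ≤ 1)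
    (hd : ‖(A : Matrix (Fin 2) (Fin 2) ℚ_[p]).det‖ = 1) (i j : Fin 2) :
    ‖((A⁻¹ : GL (Fin 2) ℚ_[p]) : Matrix (Fin 2) (Fin 2) ℚ_[p]) i j‖ ≤ 1 := by
  rw [Matrix.coe_units_inv, Matrix.inv_def, Matrix.adjugate_fin_two, Ring.inverse_eq_inv',
    Matrix.smul_apply, smul_eq_mul, norm_mul, norm_inv, hd, inv_one, one_mul]
  fin_cases i <;> fin_cases j <;> simp [h]

theorem mem_stdStab_iff {A : GL (Fin 2) ℚ_[p]} :
    A ∈ stdStab p ↔ (∀ i j, ‖(A : Matrix (Fin 2) (Fin 2) ℚ_[p]) i j‖ ≤ 1) ∧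
      ‖(A : Matrix (Fin 2) (Fin 2) ℚ_[p]).det‖ = 1 := by
  constructor
  · intro h
    have h1 : ∀ {B : GL (Fin 2) ℚ_[p]}, B ∈ stdStab p →
        ∀ i j, ‖(B : Matrix (Fin 2) (Fin 2) ℚ_[p]) i j‖ ≤ 1 := fun {B} hB =>
      norm_entry_le_one_of_smul_le (by rw [MulAction.mem_stabilizer_iff.1 hB])
    refine ⟨h1 h, le_antisymm (norm_det_le_one (h1 h)) ?_⟩
    have h2 := norm_det_le_one (h1 (inv_mem h))
    have h3 : ‖(A : Matrix (Fin 2) (Fin 2) ℚ_[p]).det‖ *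
        ‖((A⁻¹ : GL (Fin 2) ℚ_[p]) : Matrix (Fin 2) (Fin 2) ℚ_[p]).det‖ = 1 := by
      rw [← norm_mul, ← Matrix.det_mul, ← Units.val_mul, mul_inv_cancel, Units.val_one,
        Matrix.det_one, norm_one]
    have h4 := norm_nonneg (A : Matrix (Fin 2) (Fin 2) ℚ_[p]).det
    nlinarith
  · rintro ⟨h, hd⟩
    refine MulAction.mem_stabilizer_iff.2 (Subtype.ext (le_antisymm ?_ ?_))
    · rintro _ ⟨v, hv, rfl⟩
      exact mulVec_mem_stdLattice h hv
    · intro v hv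
      rw [mem_smul_lattice]
      exact mulVec_mem_stdLattice (inv_entry_norm_le_one h hd) hv

theorem norm_det_eq_of_smul_stdLattice_eq {A B : GL (Fin 2) ℚ_[p]}
    (h : A • stdLattice p = B • stdLattice p) :
    ‖(A : Matrix (Fin 2) (Fin 2) ℚ_[p]).det‖ = ‖(B : Matrix (Fin 2) (Fin 2) ℚ_[p]).det‖ := by
  have hm : B⁻¹ * A ∈ stdStab p := by
    refine MulAction.mem_stabilizer_iff.2 ?_
    rw [mul_smul, h, inv_smul_smul]
  have h1 := (mem_stdStab_iff.1 hm).2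
  have h2 : (A : Matrix (Fin 2) (Fin 2) ℚ_[p]) =
      (B : Matrix (Fin 2) (Fin 2) ℚ_[p]) * ((B⁻¹ * A : GL (Fin 2) ℚ_[p])) := by
    rw [← Units.val_mul, mul_inv_cancel_left]
  rw [h2, Matrix.det_mul, norm_mul, h1, mul_one]

/-! ### The lattices `ℤ_p ⊕ pⁿ ℤ_p` -/

variable (p) in
/-- The lattice `ℤ_p ⊕ pⁿ ℤ_p`. -/
def lvl (n : ℕ) : Lattice p := diagP p ^ n • stdLattice p

theorem diagP_pow_val (n : ℕ) :
    ((diagP p ^ n : GL (Fin 2) ℚ_[p]) : Matrix (Fin 2) (Fin 2) ℚ_[p]) =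
      !![1, 0; 0, (p : ℚ_[p]) ^ n] := by
  induction n with
  | zero =>
    rw [pow_zero, pow_zero, Units.val_one]
    ext i j
    fin_cases i <;> fin_cases j <;> simp
  | succ n ih =>
    rw [pow_succ, Units.val_mul, ih]
    change _ * !![1, 0; 0, (p : ℚ_[p])] = _
    ext i j
    fin_cases i <;> fin_cases j <;> simp [Matrix.mul_apply, Fin.sum_univ_two, pow_succ]

theorem lvl_zero : lvl p 0 = stdLattice p := by rw [lvl, pow_zero, one_smul]

theorem lvl_one : lvl p 1 = stdLatticeHat p := by rw [lvl, pow_one, stdLatticeHat]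

theorem mem_lvl {n : ℕ} {v : Fin 2 → ℚ_[p]} :
    v ∈ (lvl p n).1 ↔ ‖v 0‖ ≤ 1 ∧ ‖v 1‖ ≤ ‖(p : ℚ_[p]) ^ n‖ := by
  have hp : (p : ℚ_[p]) ^ n ≠ 0 := pow_ne_zero _ (norm_pos_iff.1 norm_prime_pos)
  constructor
  · rintro ⟨w, hw, rfl⟩
    rw [mulVecZp_apply, diagP_pow_val]
    have := (mem_stdLattice _).1 hw
    refine ⟨by simpa [Matrix.mulVec, dotProduct, Fin.sum_univ_two] using this.1, ?_⟩
    simp only [Matrix.mulVec, dotProduct, Fin.sum_univ_two, Matrix.of_apply, Matrix.cons_val',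
      Matrix.cons_val_one, Matrix.cons_val_fin_one, Matrix.cons_val_zero, zero_mul, zero_add,
      norm_mul]
    exact mul_le_of_le_one_right (norm_nonneg _) this.2
  · rintro ⟨h0, h1⟩
    refine ⟨![v 0, v 1 / (p : ℚ_[p]) ^ n], (mem_stdLattice _).2 ⟨by simpa using h0, ?_⟩, ?_⟩
    · simp only [Matrix.cons_val_one, Matrix.cons_val_fin_one, norm_div]
      exact div_le_one_of_le₀ h1 (norm_nonneg _)
    · rw [mulVecZp_apply, diagP_pow_val]
      ext i
      fin_cases i
      · simp [Matrix.mulVec, dotProduct, Fin.sum_univ_two]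
      · simp [Matrix.mulVec, dotProduct, Fin.sum_univ_two, mul_div_cancel₀ _ hp]

theorem norm_det_diagP_pow (n : ℕ) :
    ‖((diagP p ^ n : GL (Fin 2) ℚ_[p]) : Matrix (Fin 2) (Fin 2) ℚ_[p]).det‖ =
      ‖(p : ℚ_[p])‖ ^ n := by
  rw [diagP_pow_val, Matrix.det_fin_two]
  simp

/-! ### Normal form of lattices under scalars and `GL₂(ℤ_p)` -/

theorem exists_mem_norm_max (L : Lattice p) :
    ∃ v ∈ L.1, v ≠ 0 ∧ ∀ w ∈ L.1, ∀ i, ‖w i‖ ≤ ‖v‖ := by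
  obtain ⟨S, hS⟩ := L.2.fg
  have hne : S.Nonempty := by
    rw [Finset.nonempty_iff_ne_empty]
    rintro rfl
    have h1 := L.2.span_eq_top
    rw [← hS, Finset.coe_empty, Submodule.span_empty] at h1
    have h2 : (Pi.single 0 1 : Fin 2 → ℚ_[p]) ∈
        Submodule.span ℚ_[p] (((⊥ : Submodule ℤ_[p] (Fin 2 → ℚ_[p]))) : Set (Fin 2 → ℚ_[p])) := by
      rw [h1]; trivial
    simp at h2
  obtain ⟨v, hv, hmax⟩ := S.exists_max_image (fun v => ‖v‖) hne
  have hbound : ∀ w ∈ L.1, ∀ i, ‖w i‖ ≤ ‖v‖ := by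
    intro w hw
    rw [← hS] at hw
    induction hw using Submodule.span_induction with
    | mem x hx => exact fun i => (norm_le_pi_norm x i).trans (hmax x hx)
    | zero => simp
    | add x y _ _ hx hy => exact fun i => norm_add_le_of_le (hx i) (hy i)
    | smul c x _ hx =>
      intro i
      change ‖(c : ℚ_[p]) * x i‖ ≤ _
      rw [norm_mul]
      exact (mul_le_of_le_one_left (norm_nonneg _) c.2).trans (hx i)
  refine ⟨v, hS ▸ Submodule.subset_span hv, ?_, hbound⟩
  rintro rfl
  have h1 := L.2.span_eq_top
  have h3 : (Pi.single 0 1 : Fin 2 → ℚ_[p]) ∈ Submodule.span ℚ_[p] (L.1 : Set (Fin 2 → ℚ_[p])) := by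
    rw [h1]; trivial
  have h2 : (L.1 : Set (Fin 2 → ℚ_[p])) ⊆ {0} := by
    intro w hw
    ext i
    simpa using hbound w hw i
  have h4 := Submodule.span_mono h2 h3
  simp at h4

theorem exists_stdStab_mulVec_single {v : Fin 2 → ℚ_[p]} (hv : v ∈ (stdLattice p).1)
    (h1 : ‖v 0‖ = 1 ∨ ‖v 1‖ = 1) :
    ∃ k ∈ stdStab p, (k : Matrix (Fin 2) (Fin 2) ℚ_[p]).mulVec (Pi.single 0 1) = v := by
  have h01 := (mem_stdLattice _).1 hv
  rcases h1 with h | h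
  · have hd : (!![v 0, 0; v 1, 1] : Matrix (Fin 2) (Fin 2) ℚ_[p]).det = v 0 := by
      simp [Matrix.det_fin_two]
    refine ⟨Matrix.GeneralLinearGroup.mkOfDetNeZero !![v 0, 0; v 1, 1] ?_, ?_, ?_⟩
    · rw [hd, ← norm_pos_iff, h]; exact one_pos
    · refine mem_stdStab_iff.2 ⟨fun i j => ?_, ?_⟩
      · fin_cases i <;> fin_cases j <;> simp [Matrix.GeneralLinearGroup.mkOfDetNeZero, h01]
      · exact (congrArg norm hd).trans h
    · rw [Matrix.mulVec_single_one]
      ext i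
      fin_cases i <;> simp [Matrix.GeneralLinearGroup.mkOfDetNeZero]
  · have hd : (!![v 0, -1; v 1, 0] : Matrix (Fin 2) (Fin 2) ℚ_[p]).det = v 1 := by
      simp [Matrix.det_fin_two]
    refine ⟨Matrix.GeneralLinearGroup.mkOfDetNeZero !![v 0, -1; v 1, 0] ?_, ?_, ?_⟩
    · rw [hd, ← norm_pos_iff, h]; exact one_pos
    · refine mem_stdStab_iff.2 ⟨fun i j => ?_, ?_⟩
      · fin_cases i <;> fin_cases j <;> simp [Matrix.GeneralLinearGroup.mkOfDetNeZero, h01]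
      · exact (congrArg norm hd).trans h
    · rw [Matrix.mulVec_single_one]
      ext i
      fin_cases i <;> simp [Matrix.GeneralLinearGroup.mkOfDetNeZero]

/-- Containing the first basis vector lets `L` split as `ℤ_p` plus its projection to the second
axis, and that projection is a nonzero ideal of `ℤ_p`. -/
theorem lattice_eq_lvl {L : Lattice p} (hle : L.1 ≤ (stdLattice p).1)
    (h1 : (Pi.single 0 1 : Fin 2 → ℚ_[p]) ∈ L.1) : ∃ n, L = lvl p n := by
  have hsnd : ∀ v ∈ L.1, (Pi.single 1 (v 1) : Fin 2 → ℚ_[p]) ∈ L.1 := by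
    intro v hv
    have h2 : (Pi.single 1 (v 1) : Fin 2 → ℚ_[p]) = v - v 0 • Pi.single 0 1 := by
      ext i
      fin_cases i <;> simp
    rw [h2]
    exact L.1.sub_mem hv (smul_mem_lattice (hle hv).1 h1)
  have hpow : ∀ {y : ℚ_[p]} {n : ℕ}, (Pi.single 1 y : Fin 2 → ℚ_[p]) ∈ L.1 →
      ‖y‖ = ‖(p : ℚ_[p]) ^ n‖ → ∀ z, ‖z‖ ≤ ‖y‖ → (Pi.single 1 z : Fin 2 → ℚ_[p]) ∈ L.1 := by
    intro y n hy hn z hz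
    have hy0 : y ≠ 0 := by
      rw [← norm_pos_iff, hn, norm_pow]
      exact pow_pos norm_prime_pos n
    have h2 : (Pi.single 1 z : Fin 2 → ℚ_[p]) = (z / y) • Pi.single 1 y := by
      ext i
      fin_cases i <;> simp [hy0]
    rw [h2]
    refine smul_mem_lattice ?_ hy
    rw [norm_div]
    exact div_le_one_of_le₀ hz (norm_nonneg _)
  -- Otherwise the second coordinate vanishes on `L`, which then cannot span the plane. The least
  -- such `n` is the required level.
  have hex : ∃ n : ℕ, (Pi.single 1 ((p : ℚ_[p]) ^ n) : Fin 2 → ℚ_[p]) ∈ L.1 := by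
    by_contra! hno
    have h2 : ∀ v ∈ L.1, v 1 = 0 := by
      intro v hv
      by_contra hv0
      obtain ⟨n, hn⟩ := exists_norm_eq_prime_pow hv0 (hle hv).2
      exact hno n (hpow (hsnd v hv) hn _ hn.ge)
    have h3 : Submodule.span ℚ_[p] (L.1 : Set (Fin 2 → ℚ_[p])) ≤
        LinearMap.ker (LinearMap.proj (R := ℚ_[p]) (φ := fun _ : Fin 2 => ℚ_[p]) 1) :=
      Submodule.span_le.2 h2
    rw [L.2.span_eq_top] at h3
    have h4 := h3 (show (Pi.single 1 1 : Fin 2 → ℚ_[p]) ∈ ⊤ from trivial)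
    simp at h4
  classical
  refine ⟨Nat.find hex, Subtype.ext (Submodule.ext fun v => ?_)⟩
  rw [mem_lvl]
  constructor
  · intro hv
    refine ⟨(hle hv).1, ?_⟩
    by_cases hv0 : v 1 = 0
    · rw [hv0, norm_zero]; exact norm_nonneg _
    · obtain ⟨n, hn⟩ := exists_norm_eq_prime_pow hv0 (hle hv).2
      have := Nat.find_min' hex (hpow (hsnd v hv) hn _ hn.ge)
      rw [hn, norm_pow, norm_pow]
      exact pow_le_pow_of_le_one (norm_nonneg _) norm_prime_lt_one.le this
  · rintro ⟨h0, h1'⟩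
    have h2 : v = v 0 • (Pi.single 0 1 : Fin 2 → ℚ_[p]) + Pi.single 1 (v 1) := by
      ext i
      fin_cases i <;> simp
    rw [h2]
    exact L.1.add_mem (smul_mem_lattice h0 h1) (hpow (Nat.find_spec hex) rfl _ h1')

/-- A vector of maximal norm, divided by its largest coordinate, becomes primitive. Some `k ∈
GL₂(ℤ_p)` has it as first column, and undoing `k` reduces to `lattice_eq_lvl`. -/
theorem exists_lattice_eq (L : Lattice p) :
    ∃ c : ℚ_[p]ˣ, ∃ k ∈ stdStab p, ∃ n, L = scal c • k • lvl p n := by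
  obtain ⟨v, hv, hv0, hmax⟩ := exists_mem_norm_max L
  obtain ⟨i, hi⟩ : ∃ i, ‖v i‖ = ‖v‖ := by
    by_contra! hne
    have hlt : ∀ i, ‖v i‖ < ‖v‖ := fun i => lt_of_le_of_ne (norm_le_pi_norm v i) (hne i)
    exact lt_irrefl _ ((pi_norm_lt_iff (norm_pos_iff.2 hv0)).2 hlt)
  have hvi : v i ≠ 0 := by rw [← norm_pos_iff, hi, norm_pos_iff]; exact hv0
  set c : ℚ_[p]ˣ := Units.mk0 (v i) hvi with hc
  have hle : ((scal c)⁻¹ • L).1 ≤ (stdLattice p).1 := by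
    intro w hw
    rw [mem_smul_lattice, inv_inv, scal_mulVec] at hw
    have key : ∀ j, ‖w j‖ ≤ 1 := fun j => by
      have := hmax _ hw j
      rw [Pi.smul_apply, smul_eq_mul, norm_mul, ← hi] at this
      exact le_of_mul_le_mul_left (by simpa [hc] using this) (norm_pos_iff.2 hvi)
    exact ⟨key 0, key 1⟩
  have hmem : (v i)⁻¹ • v ∈ ((scal c)⁻¹ • L).1 := by
    rw [mem_smul_lattice, inv_inv, scal_mulVec, hc, Units.val_mk0, smul_inv_smul₀ hvi]
    exact hv
  have h1 : ‖((v i)⁻¹ • v) i‖ = 1 := by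
    rw [Pi.smul_apply, smul_eq_mul, inv_mul_cancel₀ hvi, norm_one]
  obtain ⟨k, hk, hkv⟩ := exists_stdStab_mulVec_single (hle hmem) (by
    fin_cases i
    exacts [Or.inl h1, Or.inr h1])
  obtain ⟨n, hn⟩ := lattice_eq_lvl (L := k⁻¹ • (scal c)⁻¹ • L) (by
      have h2 : k⁻¹ • stdLattice p = stdLattice p := MulAction.mem_stabilizer_iff.1 (inv_mem hk)
      rw [← h2, lattice_smul_le_iff]
      exact hle) (by
      rw [mem_smul_lattice, inv_inv, hkv]
      exact hmem)
  exact ⟨c, k, hk, n, by rw [← hn, smul_inv_smul, smul_inv_smul]⟩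

theorem exists_vertex_eq (v : Vertex p) : ∃ k ∈ stdStab p, ∃ n, v = k • Vertex.mk (lvl p n) := by
  induction v using Quotient.inductionOn with
  | h L =>
    obtain ⟨c, k, hk, n, h⟩ := exists_lattice_eq L
    exact ⟨k, hk, n, (mk_eq_mk_iff.2 ⟨c, h⟩ : Vertex.mk (k • lvl p n) = Vertex.mk L).symm⟩

theorem lvl_le_stdLattice (n : ℕ) : (lvl p n).1 ≤ (stdLattice p).1 := by
  intro v hv
  have := mem_lvl.1 hv
  refine ⟨this.1, this.2.trans ?_⟩
  rw [norm_pow]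
  exact pow_le_one₀ (norm_nonneg _) norm_prime_lt_one.le

theorem single_mem_lvl (n : ℕ) : (Pi.single 0 1 : Fin 2 → ℚ_[p]) ∈ (lvl p n).1 :=
  mem_lvl.2 ⟨by simp, by simp⟩

/-- Both `lvl p n` and `k • lvl p m` lie in the standard lattice and contain a primitive vector, so
neither can be a nontrivial rescaling of such a lattice. -/
theorem norm_eq_one_of_lvl_eq {c : ℚ_[p]ˣ} {k : GL (Fin 2) ℚ_[p]} (hk : k ∈ stdStab p) {m n : ℕ}
    (h : lvl p n = scal c • k • lvl p m) : ‖(c : ℚ_[p])‖ = 1 := by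
  have hkL : ∀ {k : GL (Fin 2) ℚ_[p]}, k ∈ stdStab p → ∀ m, (k • lvl p m).1 ≤ (stdLattice p).1 := by
    intro k hk m
    rw [← MulAction.mem_stabilizer_iff.1 hk, lattice_smul_le_iff]
    exact lvl_le_stdLattice m
  have key : ∀ {c : ℚ_[p]ˣ} {k : GL (Fin 2) ℚ_[p]}, k ∈ stdStab p → ∀ {m n : ℕ},
      lvl p n = scal c • k • lvl p m → 1 ≤ ‖(c : ℚ_[p])‖ := by
    intro c k hk m n h
    have h1 := single_mem_lvl (p := p) n
    rw [h] at h1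
    obtain ⟨w, hw, hw'⟩ := h1
    rw [mulVecZp_apply, scal_mulVec] at hw'
    have h2 : (c : ℚ_[p]) * w 0 = 1 := by simpa using congrFun hw' 0
    have h3 := (hkL hk m hw).1
    calc (1 : ℝ) = ‖(c : ℚ_[p])‖ * ‖w 0‖ := by rw [← norm_mul, h2, norm_one]
      _ ≤ ‖(c : ℚ_[p])‖ := mul_le_of_le_one_right (norm_nonneg _) h3
  refine le_antisymm ?_ (key hk h)
  have h' : lvl p m = scal c⁻¹ • k⁻¹ • lvl p n := by
    rw [h, ← mul_smul, ← mul_smul, ← mul_smul, scal_comm, mul_assoc]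
    have : scal c⁻¹ * (scal c * k) = k := by
      rw [← mul_assoc, scal, scal, ← map_mul, inv_mul_cancel, map_one, one_mul]
    rw [mul_assoc, this, inv_mul_cancel, one_smul]
  have := key (inv_mem hk) h'
  rw [Units.val_inv_eq_inv_val, norm_inv] at this
  exact (one_le_inv₀ (norm_pos_iff.2 c.ne_zero)).1 this

theorem scal_mem_stdStab {c : ℚ_[p]ˣ} (hc : ‖(c : ℚ_[p])‖ = 1) : scal c ∈ stdStab p := by
  refine mem_stdStab_iff.2 ⟨fun i j => ?_, by rw [norm_det_scal, hc, one_pow]⟩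
  rw [scal_val]
  fin_cases i <;> fin_cases j <;> simp [hc]

theorem norm_det_lvl_eq {A : GL (Fin 2) ℚ_[p]} {c : ℚ_[p]ˣ} {k : GL (Fin 2) ℚ_[p]}
    (hk : k ∈ stdStab p) {m : ℕ} (h : A • stdLattice p = scal c • k • lvl p m) :
    ‖(A : Matrix (Fin 2) (Fin 2) ℚ_[p]).det‖ = ‖(c : ℚ_[p])‖ ^ 2 * ‖(p : ℚ_[p])‖ ^ m := by
  rw [lvl, ← mul_smul, ← mul_smul] at h
  have := norm_det_eq_of_smul_stdLattice_eq h
  rw [this, Units.val_mul, Units.val_mul, Matrix.det_mul, Matrix.det_mul, norm_mul, norm_mul,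
    norm_det_scal, (mem_stdStab_iff.1 hk).2, norm_det_diagP_pow, mul_one]

/-- Once the homothety factor is known to be a unit, comparing determinants gives `|p|ᵐ = |p|ⁿ`. -/
theorem level_unique {k k' : GL (Fin 2) ℚ_[p]} (hk : k ∈ stdStab p) (hk' : k' ∈ stdStab p)
    {m n : ℕ} (h : k • Vertex.mk (lvl p m) = k' • Vertex.mk (lvl p n)) : m = n := by
  have h1 : Vertex.mk ((k'⁻¹ * k) • lvl p m) = Vertex.mk (lvl p n) := by
    rw [← smul_mk, mul_smul, h, inv_smul_smul]
  obtain ⟨c, hc⟩ := mk_eq_mk_iff.1 h1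
  have hkk := mul_mem (inv_mem hk') hk
  have hn := norm_eq_one_of_lvl_eq hkk hc
  have h2 := norm_det_lvl_eq (A := diagP p ^ n) hkk hc
  rw [hn, one_pow, one_mul, norm_det_diagP_pow] at h2
  exact (pow_right_injective₀ norm_prime_pos norm_prime_lt_one.ne h2).symm

end Lattices

/-! ### The structure of the tree -/

section TreeStructure

variable {p : ℕ} [Fact p.Prime]

theorem scal_smul_vertex (c : ℚ_[p]ˣ) (v : Vertex p) : scal c • v = v := by
  induction v using Quotient.inductionOn with
  | h L => exact (mk_eq_mk_iff.2 ⟨c, rfl⟩ : Vertex.mk L = Vertex.mk (scal c • L)).symm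

theorem mk_lvl_zero : Vertex.mk (lvl p 0) = vStar p := by rw [lvl_zero, vStar]

theorem mk_lvl_one : Vertex.mk (lvl p 1) = vHat p := by rw [lvl_one, vHat]

theorem stdStab_smul_vStar {k : GL (Fin 2) ℚ_[p]} (hk : k ∈ stdStab p) :
    k • vStar p = vStar p := by
  rw [vStar, smul_mk, MulAction.mem_stabilizer_iff.1 hk]

theorem exists_eq_scal_mul {A : GL (Fin 2) ℚ_[p]} (hA : A • vStar p = vStar p) :
    ∃ c : ℚ_[p]ˣ, ∃ k ∈ stdStab p, A = scal c * k := by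
  rw [vStar, smul_mk] at hA
  obtain ⟨c, hc⟩ := mk_eq_mk_iff.1 hA.symm
  refine ⟨c, (scal c)⁻¹ * A, MulAction.mem_stabilizer_iff.2 ?_, (mul_inv_cancel_left _ _).symm⟩
  rw [mul_smul, hc, inv_smul_smul]

theorem mem_diagP_pow_smul {n : ℕ} {L : Lattice p} {v : Fin 2 → ℚ_[p]} :
    v ∈ (diagP p ^ n • L).1 ↔ (![v 0, v 1 / (p : ℚ_[p]) ^ n] : Fin 2 → ℚ_[p]) ∈ L.1 := by
  have hp : (p : ℚ_[p]) ^ n ≠ 0 := pow_ne_zero _ (norm_pos_iff.1 norm_prime_pos)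
  have key : ∀ w : Fin 2 → ℚ_[p], ((diagP p ^ n : GL (Fin 2) ℚ_[p]) :
      Matrix (Fin 2) (Fin 2) ℚ_[p]).mulVec w = ![w 0, (p : ℚ_[p]) ^ n * w 1] := fun w => by
    rw [diagP_pow_val]
    ext i
    fin_cases i <;> simp [Matrix.mulVec, dotProduct, Fin.sum_univ_two]
  constructor
  · rintro ⟨w, hw, rfl⟩
    rw [mulVecZp_apply, key]
    have hw' : (![![w 0, (p : ℚ_[p]) ^ n * w 1] 0, ![w 0, (p : ℚ_[p]) ^ n * w 1] 1 / (p : ℚ_[p]) ^ n] :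
        Fin 2 → ℚ_[p]) = w := by
      ext i
      fin_cases i
      · simp
      · simp [mul_div_cancel_left₀ _ hp]
    rw [hw']
    exact hw
  · intro h
    refine ⟨_, h, ?_⟩
    rw [mulVecZp_apply, key]
    ext i
    fin_cases i
    · simp
    · simp [mul_div_cancel₀ _ hp]

theorem mem_scal_prime_stdLattice {v : Fin 2 → ℚ_[p]} :
    v ∈ (scal (primeUnit p) • stdLattice p).1 ↔ ‖v 0‖ ≤ ‖(p : ℚ_[p])‖ ∧ ‖v 1‖ ≤ ‖(p : ℚ_[p])‖ := by
  constructor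
  · rintro ⟨w, hw, rfl⟩
    rw [mulVecZp_apply, scal_mulVec]
    simp only [Pi.smul_apply, smul_eq_mul, norm_mul, primeUnit, Units.val_mk0]
    exact ⟨mul_le_of_le_one_right (norm_nonneg _) hw.1,
      mul_le_of_le_one_right (norm_nonneg _) hw.2⟩
  · rintro ⟨h0, h1⟩
    refine ⟨(p : ℚ_[p])⁻¹ • v, ⟨?_, ?_⟩, ?_⟩
    · rw [Pi.smul_apply, smul_eq_mul, norm_mul, norm_inv, inv_mul_le_one₀ norm_prime_pos]
      exact h0
    · rw [Pi.smul_apply, smul_eq_mul, norm_mul, norm_inv, inv_mul_le_one₀ norm_prime_pos]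
      exact h1
    · rw [mulVecZp_apply, scal_mulVec]
      exact smul_inv_smul₀ (norm_pos_iff.1 norm_prime_pos) v

theorem stdLattice_le_of_single_mem {L : Lattice p}
    (h0 : (Pi.single 0 1 : Fin 2 → ℚ_[p]) ∈ L.1) (h1 : (Pi.single 1 1 : Fin 2 → ℚ_[p]) ∈ L.1) :
    (stdLattice p).1 ≤ L.1 := by
  intro v hv
  have h2 : v = v 0 • (Pi.single 0 1 : Fin 2 → ℚ_[p]) + v 1 • Pi.single 1 1 := by
    ext i
    fin_cases i <;> simp
  rw [h2]
  exact L.1.add_mem (smul_mem_lattice hv.1 h0) (smul_mem_lattice hv.2 h1)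

/-- The sublattices strictly between `p Λ` and `Λ = ℤ_p ⊕ ℤ_p`. -/
theorem sublattice_cases {L : Lattice p} (h₁ : (scal (primeUnit p) • stdLattice p).1 < L.1)
    (h₂ : L.1 < (stdLattice p).1) :
    L = lvl p 1 ∨ ∃ c : ℚ_[p], ‖c‖ ≤ 1 ∧
      ∀ v, v ∈ L.1 ↔ ‖v 0 - c * v 1‖ ≤ ‖(p : ℚ_[p])‖ ∧ ‖v 1‖ ≤ 1 := by
  have hsmall : ∀ v : Fin 2 → ℚ_[p], ‖v 0‖ ≤ ‖(p : ℚ_[p])‖ → ‖v 1‖ ≤ ‖(p : ℚ_[p])‖ → v ∈ L.1 :=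
    fun v h0 h1 => h₁.le (mem_scal_prime_stdLattice.2 ⟨h0, h1⟩)
  -- The reduction of `u` mod `p` spans the line in `𝔽_p²` that corresponds to `L`. If `u 1` is a
  -- unit the line is that of `(c, 1)` with `c = u 0 / u 1`; otherwise it is the first axis, which
  -- gives `ℤ_p ⊕ pℤ_p`.
  obtain ⟨u, hu, hu'⟩ := Set.exists_of_ssubset h₁
  have hunit : ∀ {x y : ℚ_[p]}, ‖y‖ = 1 → (y⁻¹ * x) * y = x := fun {x y} hy => by
    have : y ≠ 0 := norm_pos_iff.1 (hy ▸ one_pos)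
    field_simp
  by_cases h1 : ‖u 1‖ = 1
  · right
    have hu1 : u 1 ≠ 0 := norm_pos_iff.1 (h1 ▸ one_pos)
    have hinv : ‖(u 1)⁻¹‖ ≤ 1 := by rw [norm_inv, h1, inv_one]
    have hc : ‖(u 1)⁻¹ * u 0‖ ≤ 1 := by
      rw [norm_mul]
      exact mul_le_one₀ hinv (norm_nonneg _) (h₂.le hu).1
    have hcm : (![(u 1)⁻¹ * u 0, 1] : Fin 2 → ℚ_[p]) ∈ L.1 := by
      have h2 := smul_mem_lattice hinv hu
      convert h2 using 1
      ext i
      fin_cases i <;> simp [hu1]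
    set c := (u 1)⁻¹ * u 0 with hcdef
    refine ⟨c, hc, fun v => ⟨fun hv => ⟨?_, (h₂.le hv).2⟩, fun hv => ?_⟩⟩
    · by_contra hlt
      have hx : (Pi.single 0 (v 0 - c * v 1) : Fin 2 → ℚ_[p]) ∈ L.1 := by
        have h2 := L.1.sub_mem hv (smul_mem_lattice (h₂.le hv).2 hcm)
        convert h2 using 1
        ext i
        fin_cases i <;> simp [mul_comm]
      have hn : ‖v 0 - c * v 1‖ = 1 := by
        refine le_antisymm (by simpa using (h₂.le hx).1) (not_lt.1 fun h => hlt (norm_le_norm_prime h))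
      have hne : v 0 - c * v 1 ≠ 0 := norm_pos_iff.1 (hn ▸ one_pos)
      have he0 : (Pi.single 0 1 : Fin 2 → ℚ_[p]) ∈ L.1 := by
        have h2 := smul_mem_lattice (c := (v 0 - c * v 1)⁻¹) (by rw [norm_inv, hn, inv_one]) hx
        convert h2 using 1
        ext i
        fin_cases i <;> simp [hne]
      refine h₂.not_ge (stdLattice_le_of_single_mem he0 ?_)
      have h2 := L.1.sub_mem hcm (smul_mem_lattice hc he0)
      convert h2 using 1
      ext i
      fin_cases i <;> simp
    · have h2 : v = (Pi.single 0 (v 0 - c * v 1) : Fin 2 → ℚ_[p]) + v 1 • ![c, 1] := by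
        ext i
        fin_cases i <;> simp [mul_comm]
      rw [h2]
      refine L.1.add_mem (hsmall _ ?_ ?_) (smul_mem_lattice hv.2 hcm)
      · simpa using hv.1
      · simp
  · left
    have hu1 : ‖u 1‖ ≤ ‖(p : ℚ_[p])‖ := norm_le_norm_prime (lt_of_le_of_ne (h₂.le hu).2 h1)
    have hu0 : ‖u 0‖ = 1 := by
      refine le_antisymm (h₂.le hu).1 (not_lt.1 fun h => hu' ?_)
      exact mem_scal_prime_stdLattice.2 ⟨norm_le_norm_prime h, hu1⟩
    have hne : u 0 ≠ 0 := norm_pos_iff.1 (hu0 ▸ one_pos)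
    have hu0' : (Pi.single 0 (u 0) : Fin 2 → ℚ_[p]) ∈ L.1 := by
      have h2 := L.1.sub_mem hu (hsmall (Pi.single 1 (u 1)) (by simp) (by simpa using hu1))
      convert h2 using 1
      ext i
      fin_cases i <;> simp
    have he0 : (Pi.single 0 1 : Fin 2 → ℚ_[p]) ∈ L.1 := by
      have h2 := smul_mem_lattice (c := (u 0)⁻¹) (by rw [norm_inv, hu0, inv_one]) hu0'
      convert h2 using 1
      ext i
      fin_cases i <;> simp [hne]
    refine Subtype.ext (Submodule.ext fun v => ?_)
    rw [mem_lvl, pow_one]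
    refine ⟨fun hv => ⟨(h₂.le hv).1, ?_⟩, fun hv => ?_⟩
    · by_contra hlt
      have hx : (Pi.single 1 (v 1) : Fin 2 → ℚ_[p]) ∈ L.1 := by
        have h2 := L.1.sub_mem hv (smul_mem_lattice (h₂.le hv).1 he0)
        convert h2 using 1
        ext i
        fin_cases i <;> simp
      have hn : ‖v 1‖ = 1 :=
        le_antisymm (h₂.le hv).2 (not_lt.1 fun h => hlt (norm_le_norm_prime h))
      have hne : v 1 ≠ 0 := norm_pos_iff.1 (hn ▸ one_pos)
      refine h₂.not_ge (stdLattice_le_of_single_mem he0 ?_)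
      have h2 := smul_mem_lattice (c := (v 1)⁻¹) (by rw [norm_inv, hn, inv_one]) hx
      convert h2 using 1
      ext i
      fin_cases i <;> simp [hne]
    · have h2 : v = v 0 • (Pi.single 0 1 : Fin 2 → ℚ_[p]) + Pi.single 1 (v 1) := by
        ext i
        fin_cases i <;> simp
      rw [h2]
      exact L.1.add_mem (smul_mem_lattice hv.1 he0) (hsmall _ (by simp) (by simpa using hv.2))

theorem exists_mem_stdStab_mulVec (A : Matrix (Fin 2) (Fin 2) ℚ_[p]) (h : ∀ i j, ‖A i j‖ ≤ 1)
    (hd : ‖A.det‖ = 1) :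
    ∃ k ∈ stdStab p, ∀ (L : Lattice p) v, v ∈ (k • L).1 ↔ A.mulVec v ∈ L.1 := by
  set B : GL (Fin 2) ℚ_[p] := Matrix.GeneralLinearGroup.mkOfDetNeZero A
    (norm_pos_iff.1 (hd ▸ one_pos)) with hB
  refine ⟨B⁻¹, inv_mem (mem_stdStab_iff.2 ⟨h, hd⟩), fun L v => ?_⟩
  rw [mem_smul_lattice, inv_inv]
  rfl

theorem norm_shear_iff {c t x y : ℚ_[p]} (hc : ‖c‖ = 1) (ht : t ≠ 0) :
    ‖y - t * (c⁻¹ * x)‖ ≤ ‖(p : ℚ_[p])‖ * ‖t‖ ∧ ‖x‖ ≤ 1 ↔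
      ‖x - c * (y / t)‖ ≤ ‖(p : ℚ_[p])‖ ∧ ‖y‖ ≤ ‖t‖ := by
  have hc0 : c ≠ 0 := norm_pos_iff.1 (hc ▸ one_pos)
  have ht0 : 0 < ‖t‖ := norm_pos_iff.2 ht
  have h1 : y - t * (c⁻¹ * x) = -(c⁻¹ * (x - c * (y / t)) * t) := by
    field_simp
    ring
  have h2 : ‖c * (y / t)‖ ≤ 1 ↔ ‖y‖ ≤ ‖t‖ := by
    rw [norm_mul, hc, one_mul, norm_div, div_le_one₀ ht0]
  rw [h1, norm_neg, norm_mul, norm_mul, norm_inv, hc, inv_one, one_mul, mul_le_mul_iff_left₀ ht0,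
    ← h2]
  refine and_congr_right fun h => ⟨fun h0 => ?_, fun h0 => ?_⟩
  · simpa using norm_sub_le_of_le h0 (h.trans norm_prime_lt_one.le)
  · simpa using norm_add_le_of_le (h.trans norm_prime_lt_one.le) h0

/-- The neighbours are the sublattices of index `p`, transported by `diag(1, pⁿ)`. All of them are
moved to level `n + 1` by elements fixing the vertex, except, when `n > 0`, the one attached to `c ≡
0 mod p`, which leads back towards `v_*`. -/
theorem adj_lvl_cases {n : ℕ} {w : Vertex p} (h : (tree p).Adj (Vertex.mk (lvl p n)) w) :
    (∃ k ∈ stdStab p, k • Vertex.mk (lvl p n) = Vertex.mk (lvl p n) ∧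
      w = k • Vertex.mk (lvl p (n + 1))) ∨ ∃ m, n = m + 1 ∧ w = Vertex.mk (lvl p m) := by
  obtain ⟨L₁, L₂, hv, rfl, h₁, h₂⟩ := h
  obtain ⟨d, rfl⟩ := mk_eq_mk_iff.1 hv
  set N : Lattice p := (diagP p ^ n)⁻¹ • (scal d)⁻¹ • L₂ with hN
  have hL₂ : L₂ = scal d • diagP p ^ n • N := by rw [hN, smul_inv_smul, smul_inv_smul]
  have hw : Vertex.mk L₂ = Vertex.mk (diagP p ^ n • N) := by
    rw [hL₂, ← smul_mk, scal_smul_vertex]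
  rw [hw]
  have hp : (p : ℚ_[p]) ^ n ≠ 0 := pow_ne_zero _ (norm_pos_iff.1 norm_prime_pos)
  have hp0 : 0 < ‖(p : ℚ_[p]) ^ n‖ := norm_pos_iff.2 hp
  have hpn : ‖(p : ℚ_[p]) ^ n‖ ≤ 1 := by
    rw [norm_pow]
    exact pow_le_one₀ (norm_nonneg _) norm_prime_lt_one.le
  have h₁' : (scal (primeUnit p) • stdLattice p).1 < N.1 := by
    rw [← lattice_smul_lt_iff (diagP p ^ n), ← lattice_smul_lt_iff (scal d), ← hL₂]
    have : scal d • diagP p ^ n • scal (primeUnit p) • stdLattice p =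
        scal (primeUnit p) • scal d • lvl p n := by
      rw [lvl, ← mul_smul, ← mul_smul, ← mul_smul, ← mul_smul, mul_assoc,
        ← scal_comm (primeUnit p), ← mul_assoc, scal_comm (primeUnit p) (scal d)]
    rw [this, scal_smul_val (primeUnit p)]
    exact h₁
  have h₂' : N.1 < (stdLattice p).1 := by
    rw [← lattice_smul_lt_iff (diagP p ^ n), ← lattice_smul_lt_iff (scal d), ← hL₂]
    exact h₂
  rcases sublattice_cases h₁' h₂' with hN1 | ⟨c, hc, hN1⟩
  · left
    refine ⟨1, one_mem _, one_smul _ _, ?_⟩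
    rw [one_smul, hN1, lvl, lvl, ← mul_smul, ← pow_add]
  have hmem : ∀ v, v ∈ (diagP p ^ n • N).1 ↔
      ‖v 0 - c * (v 1 / (p : ℚ_[p]) ^ n)‖ ≤ ‖(p : ℚ_[p])‖ ∧ ‖v 1‖ ≤ ‖(p : ℚ_[p]) ^ n‖ := by
    intro v
    rw [mem_diagP_pow_smul, hN1]
    simp only [Matrix.cons_val_zero, Matrix.cons_val_one, Matrix.cons_val_fin_one, norm_div,
      div_le_one₀ hp0]
  by_cases hc1 : ‖c‖ = 1
  · left
    have hc0 : c ≠ 0 := norm_pos_iff.1 (hc1 ▸ one_pos)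
    -- The matrix is the inverse of the desired `k`: it preserves `ℤ_p ⊕ pⁿℤ_p` and carries `{v 0 ≡
    -- c v 1 / pⁿ mod p}` to `ℤ_p ⊕ pⁿ⁺¹ℤ_p`. Dividing by `c` is where `c` has to be a unit.
    obtain ⟨k, hk, hkL⟩ := exists_mem_stdStab_mulVec
      (!![c⁻¹, 0; -((p : ℚ_[p]) ^ n * c⁻¹), 1] : Matrix (Fin 2) (Fin 2) ℚ_[p])
      (fun i j => by fin_cases i <;> fin_cases j <;> (simp [hc1]; try simpa using hpn))
      (by simp [Matrix.det_fin_two, hc1])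
    have hv : ∀ v : Fin 2 → ℚ_[p], (!![c⁻¹, 0; -((p : ℚ_[p]) ^ n * c⁻¹), 1] :
        Matrix (Fin 2) (Fin 2) ℚ_[p]).mulVec v = ![c⁻¹ * v 0, v 1 - (p : ℚ_[p]) ^ n * (c⁻¹ * v 0)] := by
      intro v
      ext i
      fin_cases i
      · simp [Matrix.mulVec, dotProduct, Fin.sum_univ_two]
      · simp [Matrix.mulVec, dotProduct, Fin.sum_univ_two]
        ring
    have hn0 : ∀ v : Fin 2 → ℚ_[p], ‖c⁻¹ * v 0‖ = ‖v 0‖ := fun v => by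
      rw [norm_mul, norm_inv, hc1, inv_one, one_mul]
    refine ⟨k, hk, ?_, ?_⟩
    · rw [smul_mk]
      congr 1
      refine Subtype.ext (Submodule.ext fun v => ?_)
      rw [hkL, hv, mem_lvl, mem_lvl]
      simp only [Matrix.cons_val_zero, Matrix.cons_val_one, Matrix.cons_val_fin_one, hn0]
      refine and_congr_right fun h0 => ?_
      have h3 : ‖(p : ℚ_[p]) ^ n * (c⁻¹ * v 0)‖ ≤ ‖(p : ℚ_[p]) ^ n‖ := by
        rw [norm_mul, hn0]
        exact mul_le_of_le_one_right (norm_nonneg _) h0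
      refine ⟨fun h => ?_, fun h => norm_sub_le_of_le h h3⟩
      simpa using norm_add_le_of_le h h3
    · rw [smul_mk]
      congr 1
      refine Subtype.ext (Submodule.ext fun v => ?_)
      rw [hkL, hv, mem_lvl, hmem]
      simp only [Matrix.cons_val_zero, Matrix.cons_val_one, Matrix.cons_val_fin_one, hn0]
      rw [pow_succ', norm_mul (p : ℚ_[p]), and_comm (a := ‖v 0‖ ≤ 1)]
      exact (norm_shear_iff hc1 hp).symm
  have hcp : ‖c‖ ≤ ‖(p : ℚ_[p])‖ := norm_le_norm_prime (lt_of_le_of_ne hc hc1)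
  rcases n with _ | m
  · left
    -- At the root there is no way back: exchanging the coordinates turns this last neighbour into
    -- one of level 1.
    obtain ⟨k, hk, hkL⟩ := exists_mem_stdStab_mulVec
      (!![0, 1; 1, -c] : Matrix (Fin 2) (Fin 2) ℚ_[p])
      (fun i j => by fin_cases i <;> fin_cases j <;> simp [hc])
      (by simp [Matrix.det_fin_two])
    refine ⟨k, hk, ?_, ?_⟩
    · rw [mk_lvl_zero, stdStab_smul_vStar hk]
    · rw [smul_mk]
      congr 1
      refine Subtype.ext (Submodule.ext fun v => ?_)
      rw [hkL, mem_lvl, hmem]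
      simp only [Matrix.mulVec, dotProduct, Fin.sum_univ_two, Matrix.of_apply, Matrix.cons_val',
        Matrix.cons_val_zero, Matrix.cons_val_one, Matrix.cons_val_fin_one, zero_mul, one_mul,
        zero_add, pow_zero, div_one, norm_one, pow_one, neg_mul, ← sub_eq_add_neg]
      exact and_comm
  · right
    refine ⟨m, rfl, ?_⟩
    -- As `p ∣ c`, the congruence just says `p ∣ v 0`, so the lattice is `pℤ_p ⊕ pᵐ⁺¹ℤ_p = p (ℤ_p ⊕
    -- pᵐℤ_p)`.
    have : diagP p ^ (m + 1) • N = scal (primeUnit p) • lvl p m := by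
      refine Subtype.ext (Submodule.ext fun v => ?_)
      have hp1 : (p : ℚ_[p]) ≠ 0 := norm_pos_iff.1 norm_prime_pos
      have hs : v ∈ (scal (primeUnit p) • lvl p m).1 ↔
          ‖v 0‖ ≤ ‖(p : ℚ_[p])‖ ∧ ‖v 1‖ ≤ ‖(p : ℚ_[p]) ^ (m + 1)‖ := by
        have hi : (scal (primeUnit p))⁻¹ = scal (primeUnit p)⁻¹ := by rw [scal, scal, map_inv]
        rw [mem_smul_lattice, hi, scal_mulVec, mem_lvl]
        simp only [Pi.smul_apply, smul_eq_mul, norm_mul, Units.val_inv_eq_inv_val, norm_inv,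
          primeUnit, Units.val_mk0, pow_succ']
        rw [inv_mul_le_iff₀ norm_prime_pos, inv_mul_le_iff₀ norm_prime_pos, mul_one]
      rw [hmem, hs]
      refine and_congr_left fun h1 => ?_
      have h2 : ‖c * (v 1 / (p : ℚ_[p]) ^ (m + 1))‖ ≤ ‖(p : ℚ_[p])‖ := by
        rw [norm_mul, norm_div]
        exact (mul_le_of_le_one_right (norm_nonneg _) (div_le_one_of_le₀ h1 (norm_nonneg _))).trans hcp
      refine ⟨fun h => ?_, fun h => norm_sub_le_of_le h h2⟩
      simpa using norm_add_le_of_le h h2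
    rw [this, ← smul_mk, scal_smul_vertex]

theorem adj_cases {k : GL (Fin 2) ℚ_[p]} (hk : k ∈ stdStab p) {n : ℕ} {w : Vertex p}
    (h : (tree p).Adj (k • Vertex.mk (lvl p n)) w) :
    (∃ k' ∈ stdStab p, k • Vertex.mk (lvl p n) = k' • Vertex.mk (lvl p n) ∧
      w = k' • Vertex.mk (lvl p (n + 1))) ∨ ∃ m, n = m + 1 ∧ w = k • Vertex.mk (lvl p m) := by
  have h' := smul_adj k⁻¹ h
  rw [inv_smul_smul] at h'
  rcases adj_lvl_cases h' with ⟨k', hk', h1, h2⟩ | ⟨m, hm, h2⟩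
  · left
    exact ⟨k * k', mul_mem hk hk', by rw [mul_smul, h1], by rw [mul_smul, ← h2, smul_inv_smul]⟩
  · right
    exact ⟨m, hm, by rw [← h2, smul_inv_smul]⟩

theorem lvl_adj (n : ℕ) : (tree p).Adj (Vertex.mk (lvl p n)) (Vertex.mk (lvl p (n + 1))) := by
  have h := smul_adj (diagP p ^ n) (vStar_adj_vHat (p := p))
  rw [vStar, vHat, smul_mk, smul_mk, stdLatticeHat, ← mul_smul, ← pow_succ] at h
  exact h

/-- The chain of levels `n, n - 1, …, 0` is a walk of length `n`; a walk to `v_*` cannot be shorter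
because each step changes the level by one. -/
theorem dist_level {k : GL (Fin 2) ℚ_[p]} (hk : k ∈ stdStab p) (n : ℕ) :
    (tree p).dist (k • Vertex.mk (lvl p n)) (vStar p) = n ∧
      (tree p).Reachable (k • Vertex.mk (lvl p n)) (vStar p) := by
  have hex : ∀ n, ∃ q : (tree p).Walk (k • Vertex.mk (lvl p n)) (vStar p), q.length = n := by
    intro n
    induction n with
    | zero =>
      rw [mk_lvl_zero, stdStab_smul_vStar hk]
      exact ⟨.nil, rfl⟩
    | succ n ih =>
      obtain ⟨q, hq⟩ := ih
      exact ⟨.cons (smul_adj k (lvl_adj n)).symm q, by rw [SimpleGraph.Walk.length_cons, hq]⟩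
  have hlow : ∀ {v w : Vertex p} (q : (tree p).Walk v w), w = vStar p →
      ∃ k ∈ stdStab p, ∃ m ≤ q.length, v = k • Vertex.mk (lvl p m) := by
    intro v w q
    induction q with
    | nil =>
      rintro rfl
      exact ⟨1, one_mem _, 0, le_rfl, by rw [one_smul, mk_lvl_zero]⟩
    | cons h q ih =>
      intro hw
      obtain ⟨k, hk, m, hm, rfl⟩ := ih hw
      rw [SimpleGraph.Walk.length_cons]
      rcases adj_cases hk h.symm with ⟨k', hk', -, h2⟩ | ⟨m', rfl, h2⟩
      · exact ⟨k', hk', m + 1, by omega, h2⟩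
      · exact ⟨k, hk, m', by omega, h2⟩
  obtain ⟨q, hq⟩ := hex n
  refine ⟨le_antisymm ((SimpleGraph.dist_le q).trans hq.le) ?_, q.reachable⟩
  obtain ⟨q', hq'⟩ := q.reachable.exists_walk_length_eq_dist
  obtain ⟨k', hk', m, hm, h⟩ := hlow q' rfl
  exact ((level_unique hk hk' h).le.trans hm).trans hq'.le

/-- The distance of a vertex to `v_*`. -/
abbrev height (v : Vertex p) : ℕ := (tree p).dist v (vStar p)

theorem height_level {k : GL (Fin 2) ℚ_[p]} (hk : k ∈ stdStab p) (n : ℕ) :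
    height (k • Vertex.mk (lvl p n)) = n :=
  (dist_level hk n).1

theorem height_vStar : height (vStar p) = 0 := SimpleGraph.dist_self

theorem height_vHat : height (vHat p) = 1 := by
  have := height_level (one_mem (stdStab p)) 1
  rwa [one_smul, mk_lvl_one] at this

theorem height_adj {v w : Vertex p} (h : (tree p).Adj v w) :
    height w = height v + 1 ∨ height v = height w + 1 := by
  obtain ⟨k, hk, n, rfl⟩ := exists_vertex_eq v
  rcases adj_cases hk h with ⟨k', hk', h1, rfl⟩ | ⟨m, rfl, rfl⟩
  · left
    rw [height_level hk, height_level hk']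
  · right
    rw [height_level hk, height_level hk]

/-- Uniqueness of the parent. This is the form in which the tree property is used. -/
theorem eq_of_adj_of_height_lt {u v w : Vertex p} (hu : (tree p).Adj v u) (hw : (tree p).Adj v w)
    (hu' : height u < height v) (hw' : height w < height v) : u = w := by
  obtain ⟨k, hk, n, rfl⟩ := exists_vertex_eq v
  have key : ∀ {u}, (tree p).Adj (k • Vertex.mk (lvl p n)) u →
      height u < height (k • Vertex.mk (lvl p n)) → ∃ m, n = m + 1 ∧ u = k • Vertex.mk (lvl p m) := by
    intro u h h'
    rcases adj_cases hk h with ⟨k', hk', h1, rfl⟩ | h2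
    · rw [height_level hk, height_level hk'] at h'
      omega
    · exact h2
  obtain ⟨m, rfl, rfl⟩ := key hu hu'
  obtain ⟨m', hm, rfl⟩ := key hw hw'
  obtain rfl : m = m' := by omega
  rfl

theorem exists_parent {v : Vertex p} (hv : v ≠ vStar p) :
    ∃ u, (tree p).Adj v u ∧ height v = height u + 1 := by
  obtain ⟨k, hk, n, rfl⟩ := exists_vertex_eq v
  rcases n with _ | n
  · exact absurd (by rw [mk_lvl_zero, stdStab_smul_vStar hk]) hv
  · exact ⟨k • Vertex.mk (lvl p n), (smul_adj k (lvl_adj n)).symm, by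
      rw [height_level hk, height_level hk]⟩

theorem height_smul {A : GL (Fin 2) ℚ_[p]} (hA : A • vStar p = vStar p) (v : Vertex p) :
    height (A • v) = height v := by
  obtain ⟨c, k, hk, rfl⟩ := exists_eq_scal_mul hA
  obtain ⟨k', hk', n, rfl⟩ := exists_vertex_eq v
  rw [mul_smul, scal_smul_vertex, ← mul_smul, height_level (mul_mem hk hk'), height_level hk']

/-- Writing `A ℤ_p² = c k (ℤ_p ⊕ pⁿℤ_p)` gives `|c|² |p|ⁿ = |det A| = 1`, so `n = -2 v(c)`. -/
theorem even_height_smul_vStar {A : GL (Fin 2) ℚ_[p]}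
    (hA : ‖(A : Matrix (Fin 2) (Fin 2) ℚ_[p]).det‖ = 1) : Even (height (A • vStar p)) := by
  obtain ⟨c, k, hk, n, h⟩ := exists_lattice_eq (A • stdLattice p)
  have h1 := norm_det_lvl_eq hk h
  rw [vStar, smul_mk, h, ← smul_mk, scal_smul_vertex, ← smul_mk]
  change Even (height _)
  rw [height_level hk]
  have hp0 : (p : ℚ_[p]) ≠ 0 := norm_pos_iff.1 norm_prime_pos
  have h2 : ‖(c : ℚ_[p]) ^ 2 * (p : ℚ_[p]) ^ n‖ = 1 := by
    rw [norm_mul, norm_pow, norm_pow, ← h1, hA]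
  have hp : (1 : ℝ) < p := by exact_mod_cast (Fact.out : p.Prime).one_lt
  rw [Padic.norm_eq_zpow_neg_valuation (mul_ne_zero (pow_ne_zero _ c.ne_zero) (pow_ne_zero _ hp0)),
    zpow_eq_one_iff_right₀ (zero_le_one.trans hp.le) hp.ne',
    Padic.valuation_mul (pow_ne_zero _ c.ne_zero) (pow_ne_zero _ hp0), Padic.valuation_pow, Padic.valuation_pow,
    Padic.valuation_p] at h2
  have h3 : (n : ℤ) = -(c : ℚ_[p]).valuation + -(c : ℚ_[p]).valuation := by
    push_cast at h2
    linarith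
  exact (Int.even_coe_nat n).1 ⟨_, h3⟩

/-! ### The vertices behind `v̂_*` -/

/-- The vertices that `v̂_*` separates from `v_*`, and `v̂_*` itself. -/
def Beyond (v : Vertex p) : Prop :=
  ∃ k ∈ stdStab p, k • vHat p = vHat p ∧ ∃ n, v = k • Vertex.mk (lvl p (n + 1))

theorem beyond_vHat : Beyond (vHat p) :=
  ⟨1, one_mem _, one_smul _ _, 0, by rw [one_smul, zero_add, mk_lvl_one]⟩

theorem smul_lvl_one_eq {k k' : GL (Fin 2) ℚ_[p]} (n : ℕ) (hk : k ∈ stdStab p)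
    (hk' : k' ∈ stdStab p)
    (h : k • Vertex.mk (lvl p (n + 1)) = k' • Vertex.mk (lvl p (n + 1))) :
    k • vHat p = k' • vHat p := by
  induction n with
  | zero => rwa [zero_add, mk_lvl_one] at h
  | succ n ih =>
    have hadj : (tree p).Adj (k • Vertex.mk (lvl p (n + 1 + 1))) (k' • Vertex.mk (lvl p (n + 1))) := by
      rw [h]
      exact (smul_adj k' (lvl_adj (n + 1))).symm
    refine ih (eq_of_adj_of_height_lt (smul_adj k (lvl_adj (n + 1))).symm hadj ?_ ?_)
    · rw [height_level hk, height_level hk]; omega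
    · rw [height_level hk, height_level hk']; omega

/-- By uniqueness of parents, a vertex `k [ℤ_p ⊕ pⁿ⁺¹ℤ_p]` determines the level 1 vertex `k v̂_*`
through which its path to `v_*` passes; the choice of `k` is therefore immaterial. -/
theorem beyond_iff {k : GL (Fin 2) ℚ_[p]} (hk : k ∈ stdStab p) {n : ℕ} :
    Beyond (k • Vertex.mk (lvl p (n + 1))) ↔ k • vHat p = vHat p := by
  refine ⟨?_, fun h => ⟨k, hk, h, n, rfl⟩⟩
  rintro ⟨k', hk', h', m, h⟩
  obtain rfl : n = m := by have := level_unique hk hk' h; omega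
  rw [smul_lvl_one_eq n hk hk' h, h']

theorem Beyond.of_parent {v w : Vertex p} (hw : Beyond w) (h : (tree p).Adj v w)
    (hlt : height w < height v) : Beyond v := by
  obtain ⟨k, hk, hkv, n, rfl⟩ := hw
  rcases adj_cases hk h.symm with ⟨k', hk', h1, rfl⟩ | ⟨m, hm, rfl⟩
  · rw [beyond_iff hk', ← smul_lvl_one_eq n hk hk' h1, hkv]
  · rw [height_level hk, height_level hk] at hlt
    omega

theorem Beyond.smul {A : GL (Fin 2) ℚ_[p]} (hA : A • vStar p = vStar p)
    (hA' : A • vHat p = vHat p) {v : Vertex p} (hv : Beyond v) : Beyond (A • v) := by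
  obtain ⟨c, k, hk, rfl⟩ := exists_eq_scal_mul hA
  rw [mul_smul, scal_smul_vertex] at hA' ⊢
  obtain ⟨k', hk', hkv, n, rfl⟩ := hv
  exact ⟨k * k', mul_mem hk hk', by rw [mul_smul, hkv, hA'], n, by rw [mul_smul]⟩

theorem beyond_smul_iff {A : GL (Fin 2) ℚ_[p]} (hA : A • vStar p = vStar p)
    (hA' : A • vHat p = vHat p) {v : Vertex p} : Beyond (A • v) ↔ Beyond v := by
  refine ⟨fun h => ?_, Beyond.smul hA hA'⟩
  have := h.smul (A := A⁻¹) (inv_smul_eq_iff.2 hA.symm) (inv_smul_eq_iff.2 hA'.symm)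
  rwa [inv_smul_smul] at this

end TreeStructure

/-! ### Directed edges and balls -/

section Balls

variable {p : ℕ} [Fact p.Prime]

theorem edge_smul_fst (A : GL (Fin 2) ℚ_[p]) (e : Edge p) : (A • e).fst = A • e.fst := rfl

theorem edge_smul_snd (A : GL (Fin 2) ℚ_[p]) (e : Edge p) : (A • e).snd = A • e.snd := rfl

theorem edge_ext {e f : Edge p} (h₁ : e.fst = f.fst) (h₂ : e.snd = f.snd) : e = f :=
  SimpleGraph.Dart.ext _ _ (Prod.ext h₁ h₂)

theorem edge_mul_smul (A B : GL (Fin 2) ℚ_[p]) (e : Edge p) : (A * B) • e = A • B • e :=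
  edge_ext (mul_smul A B e.fst) (mul_smul A B e.snd)

theorem edge_one_smul (e : Edge p) : (1 : GL (Fin 2) ℚ_[p]) • e = e :=
  edge_ext (one_smul _ e.fst) (one_smul _ e.snd)

theorem smul_eStar_eq_iff {A : GL (Fin 2) ℚ_[p]} :
    A • eStar p = eStar p ↔ A • vStar p = vStar p ∧ A • vHat p = vHat p :=
  ⟨fun h => ⟨congrArg (fun e : Edge p => e.fst) h, congrArg (fun e : Edge p => e.snd) h⟩,
    fun h => edge_ext h.1 h.2⟩

theorem mkOfDetNeZero_val {A : Matrix (Fin 2) (Fin 2) ℚ_[p]} (h : A.det ≠ 0) :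
    ((Matrix.GeneralLinearGroup.mkOfDetNeZero A h : GL (Fin 2) ℚ_[p]) :
      Matrix (Fin 2) (Fin 2) ℚ_[p]) = A := rfl

theorem mulVec_single_zero (A : Matrix (Fin 2) (Fin 2) ℚ_[p]) :
    A.mulVec (Pi.single 0 1) = ![A 0 0, A 1 0] := by
  rw [Matrix.mulVec_single_one]
  ext i
  fin_cases i <;> rfl

theorem stdStab_smul_vHat_iff {k : GL (Fin 2) ℚ_[p]} (hk : k ∈ stdStab p) :
    k • vHat p = vHat p ↔ ‖(k : Matrix (Fin 2) (Fin 2) ℚ_[p]) 1 0‖ < 1 := by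
  constructor
  · intro h
    rw [← mk_lvl_one, smul_mk] at h
    obtain ⟨c, hc⟩ := mk_eq_mk_iff.1 h
    have hc1 := norm_eq_one_of_lvl_eq hk hc
    have h1 := mulVec_mem_smul_lattice (scal c)
      (mulVec_mem_smul_lattice k (single_mem_lvl (p := p) 1))
    rw [← hc, mem_lvl, scal_mulVec, mulVec_single_zero] at h1
    have h2 := h1.2
    simp only [Pi.smul_apply, Matrix.cons_val_one, Matrix.cons_val_fin_one, smul_eq_mul, norm_mul,
      hc1, one_mul, pow_one] at h2
    exact h2.trans_lt norm_prime_lt_one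
  · have key : ∀ {k : GL (Fin 2) ℚ_[p]}, k ∈ stdStab p →
        ‖(k : Matrix (Fin 2) (Fin 2) ℚ_[p]) 1 0‖ < 1 → (k • lvl p 1).1 ≤ (lvl p 1).1 := by
      rintro k hk h _ ⟨v, hv, rfl⟩
      have hv' := mem_lvl.1 hv
      have h1 := (mem_stdStab_iff.1 hk).1
      refine mem_lvl.2 ⟨(mulVec_mem_stdLattice h1 (lvl_le_stdLattice 1 hv)).1, ?_⟩
      rw [mulVecZp_apply, Matrix.mulVec, dotProduct, Fin.sum_univ_two]
      rw [pow_one] at hv' ⊢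
      refine norm_add_le_of_le ?_ ?_ <;> rw [norm_mul]
      · exact (mul_le_of_le_one_right (norm_nonneg _) hv'.1).trans (norm_le_norm_prime h)
      · exact (mul_le_of_le_one_left (norm_nonneg _) (h1 1 1)).trans hv'.2
    intro h
    rw [← mk_lvl_one, smul_mk]
    congr 1
    refine Subtype.ext (le_antisymm (key hk h) ?_)
    rw [← lattice_smul_le_iff k⁻¹, inv_smul_smul]
    refine key (inv_mem hk) ?_
    rw [Matrix.coe_units_inv, Matrix.inv_def, Matrix.adjugate_fin_two, Ring.inverse_eq_inv',
      Matrix.smul_apply, smul_eq_mul, norm_mul, norm_inv, (mem_stdStab_iff.1 hk).2]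
    simpa using h

theorem norm_diag_eq_one {k : GL (Fin 2) ℚ_[p]} (hk : k ∈ stdStab p)
    (h : ‖(k : Matrix (Fin 2) (Fin 2) ℚ_[p]) 1 0‖ < 1) :
    ‖(k : Matrix (Fin 2) (Fin 2) ℚ_[p]) 0 0‖ = 1 ∧
      ‖(k : Matrix (Fin 2) (Fin 2) ℚ_[p]) 1 1‖ = 1 := by
  obtain ⟨h1, h2⟩ := mem_stdStab_iff.1 hk
  have h4 : ¬ ‖(k : Matrix (Fin 2) (Fin 2) ℚ_[p]) 0 0‖ *
      ‖(k : Matrix (Fin 2) (Fin 2) ℚ_[p]) 1 1‖ < 1 := by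
    intro hlt
    have h5 : ‖(k : Matrix (Fin 2) (Fin 2) ℚ_[p]) 0 1 *
        (k : Matrix (Fin 2) (Fin 2) ℚ_[p]) 1 0‖ < 1 := by
      rw [norm_mul]
      exact mul_lt_one_of_nonneg_of_lt_one_right (h1 _ _) (norm_nonneg _) h
    rw [Matrix.det_fin_two] at h2
    have h6 := norm_sub_le_of_le (norm_le_norm_prime (by rwa [norm_mul])) (norm_le_norm_prime h5)
    rw [h2] at h6
    exact absurd norm_prime_lt_one (not_lt.2 h6)
  have ha := h1 0 0
  have hd := h1 1 1
  have ha0 := norm_nonneg ((k : Matrix (Fin 2) (Fin 2) ℚ_[p]) 0 0)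
  have hd0 := norm_nonneg ((k : Matrix (Fin 2) (Fin 2) ℚ_[p]) 1 1)
  constructor <;> nlinarith

theorem coe_mem_zpBall {x : ℚ_[p]} : (x : OnePoint ℚ_[p]) ∈ zpBall p ↔ ‖x‖ ≤ 1 := by
  constructor
  · rintro ⟨y, hy, hyx⟩
    rw [← OnePoint.coe_injective hyx]
    exact hy
  · exact fun h => ⟨x, h, rfl⟩

theorem infty_notMem_zpBall : (OnePoint.infty : OnePoint ℚ_[p]) ∉ zpBall p := by
  rintro ⟨y, -, hy⟩
  exact OnePoint.coe_ne_infty y hy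

variable (p) in
/-- An element of `GL₂(ℚ_p)` that reverses the edge `e_*`. -/
def flipP : GL (Fin 2) ℚ_[p] :=
  Matrix.GeneralLinearGroup.mkOfDetNeZero !![0, -1; (p : ℚ_[p]), 0] (by
    simpa [Matrix.det_fin_two] using (Fact.out : p.Prime).ne_zero)

theorem flipP_smul : flipP p • vStar p = vHat p ∧ flipP p • vHat p = vStar p := by
  have hd : (!![0, -1; 1, 0] : Matrix (Fin 2) (Fin 2) ℚ_[p]).det = 1 := by simp [Matrix.det_fin_two]
  set S : GL (Fin 2) ℚ_[p] := Matrix.GeneralLinearGroup.mkOfDetNeZero !![0, -1; 1, 0]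
    (by rw [hd]; exact one_ne_zero) with hSdef
  have hS : S ∈ stdStab p := mem_stdStab_iff.2
    ⟨fun i j => by fin_cases i <;> fin_cases j <;> simp [S, Matrix.GeneralLinearGroup.mkOfDetNeZero],
      (congrArg norm hd).trans norm_one⟩
  have h1 : flipP p = diagP p * S := by
    refine Units.ext ?_
    rw [Units.val_mul]
    change (!![0, -1; (p : ℚ_[p]), 0] : Matrix (Fin 2) (Fin 2) ℚ_[p]) =
      (!![1, 0; 0, (p : ℚ_[p])] : Matrix (Fin 2) (Fin 2) ℚ_[p]) *
        (!![0, -1; 1, 0] : Matrix (Fin 2) (Fin 2) ℚ_[p])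
    ext i j
    fin_cases i <;> fin_cases j <;> simp [Matrix.mul_apply, Fin.sum_univ_two]
  have h2 : flipP p * diagP p = scal (primeUnit p) * S := by
    refine Units.ext ?_
    rw [Units.val_mul, Units.val_mul, scal_val]
    change (!![0, -1; (p : ℚ_[p]), 0] : Matrix (Fin 2) (Fin 2) ℚ_[p]) *
      (!![1, 0; 0, (p : ℚ_[p])] : Matrix (Fin 2) (Fin 2) ℚ_[p]) =
        ((p : ℚ_[p]) • 1 : Matrix (Fin 2) (Fin 2) ℚ_[p]) *
          (!![0, -1; 1, 0] : Matrix (Fin 2) (Fin 2) ℚ_[p])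
    ext i j
    fin_cases i <;> fin_cases j <;> simp [Matrix.mul_apply, Fin.sum_univ_two]
  have hv : vHat p = diagP p • vStar p := rfl
  constructor
  · rw [h1, mul_smul, stdStab_smul_vStar hS, hv]
  · rw [hv, ← mul_smul, h2, mul_smul, scal_smul_vertex, stdStab_smul_vStar hS]

theorem diagP_pow_smul_vHat (n : ℕ) : diagP p ^ n • vHat p = Vertex.mk (lvl p (n + 1)) := by
  rw [← mk_lvl_one, smul_mk, lvl, lvl, ← mul_smul, ← pow_add]

-- Each edge is an explicit matrix times `e_*`, so containment of the ball can be tested at a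
-- well-chosen point of `ℤ_p`. Outward edges other than `e_*`, and inward edges whose source is
-- behind `v̂_*`, both fail the test.
open scoped Classical in
theorem inward_of_ball_subset {e : Edge p} (he : ball e ⊆ zpBall p) :
    e = eStar p ∨ Inward e ∧ ¬ Beyond e.fst ∧ ¬ Beyond e.snd := by
  have hA : ∀ A : GL (Fin 2) ℚ_[p], A • eStar p = e → ∀ t : ℚ_[p], ‖t‖ ≤ 1 →
      A • (t : OnePoint ℚ_[p]) ∈ zpBall p := fun A hA t ht =>
    he ⟨A, hA, t, coe_mem_zpBall.2 ht, by congr⟩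
  have hp : (p : ℚ_[p]) ≠ 0 := norm_pos_iff.1 norm_prime_pos
  obtain ⟨k, hk, n, hv⟩ := exists_vertex_eq e.fst
  have hadj := e.adj
  rw [hv] at hadj
  rcases adj_cases hk hadj with ⟨k', hk', h1, hw⟩ | ⟨m, rfl, hw⟩
  · left
    clear hadj
    rw [h1] at hv
    clear h1 hk k
    obtain ⟨hint, hdet⟩ := mem_stdStab_iff.1 hk'
    have hk'e : (k' * diagP p ^ n) • eStar p = e := by
      refine edge_ext ?_ ?_
      · rw [hv, edge_smul_fst, mul_smul]; rfl
      · rw [hw, edge_smul_snd, mul_smul]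
        exact congrArg (k' • ·) (diagP_pow_smul_vHat n)
    have hval : ((k' * diagP p ^ n : GL (Fin 2) ℚ_[p]) : Matrix (Fin 2) (Fin 2) ℚ_[p]) =
        !![k' 0 0, k' 0 1 * (p : ℚ_[p]) ^ n; k' 1 0, k' 1 1 * (p : ℚ_[p]) ^ n] := by
      rw [Units.val_mul, diagP_pow_val]
      ext i j
      fin_cases i <;> fin_cases j <;> simp [Matrix.mul_apply, Fin.sum_univ_two]
    have hpt : ∀ t : ℚ_[p], ‖t‖ ≤ 1 → k' 1 0 * t + k' 1 1 * (p : ℚ_[p]) ^ n ≠ 0 ∧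
        ‖k' 0 0 * t + k' 0 1 * (p : ℚ_[p]) ^ n‖ ≤ ‖k' 1 0 * t + k' 1 1 * (p : ℚ_[p]) ^ n‖ := by
      intro t ht
      have h2 := hA _ hk'e t ht
      rw [OnePoint.smul_some_eq_ite, hval] at h2
      simp only [Matrix.of_apply, Matrix.cons_val', Matrix.cons_val_zero, Matrix.cons_val_one,
        Matrix.cons_val_fin_one] at h2
      split_ifs at h2 with h0
      · exact absurd h2 infty_notMem_zpBall
      · refine ⟨h0, ?_⟩
        rwa [coe_mem_zpBall, norm_div, div_le_one₀ (norm_pos_iff.2 h0)] at h2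
    have hpn : ‖(p : ℚ_[p]) ^ n‖ ≤ 1 := by
      rw [norm_pow]
      exact pow_le_one₀ (norm_nonneg _) norm_prime_lt_one.le
    -- If the lower left entry were a unit, the pole of the fractional linear map would be a point
    -- of `ℤ_p`, and the ball would contain `∞`.
    have hc : ‖k' 1 0‖ < 1 := by
      refine lt_of_le_of_ne (hint 1 0) fun hc => ?_
      have hc0 : k' 1 0 ≠ 0 := norm_pos_iff.1 (hc ▸ one_pos)
      refine (hpt (-(k' 1 1 * (p : ℚ_[p]) ^ n) / k' 1 0) ?_).1 ?_
      · rw [norm_div, norm_neg, hc, div_one, norm_mul]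
        exact mul_le_one₀ (hint 1 1) (norm_nonneg _) hpn
      · field_simp
        ring
    rcases n with _ | n
    · rw [pow_zero, mul_one] at hk'e
      rw [← hk'e]
      exact smul_eStar_eq_iff.2 ⟨stdStab_smul_vStar hk', (stdStab_smul_vHat_iff hk').2 hc⟩
    · exfalso
      have hlt : ‖(p : ℚ_[p]) ^ (n + 1)‖ ≤ ‖(p : ℚ_[p])‖ := by
        rw [pow_succ, norm_mul, norm_pow]
        exact mul_le_of_le_one_left (norm_nonneg _)
          (pow_le_one₀ (norm_nonneg _) norm_prime_lt_one.le)
      -- At `t = 1` the denominator is divisible by `p` while the numerator is a unit.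
      have h2 := (hpt 1 norm_one.le).2
      rw [mul_one, mul_one] at h2
      have h3 : ‖k' 1 0 + k' 1 1 * (p : ℚ_[p]) ^ (n + 1)‖ ≤ ‖(p : ℚ_[p])‖ := by
        refine norm_add_le_of_le (norm_le_norm_prime hc) ?_
        rw [norm_mul]
        exact (mul_le_of_le_one_left (norm_nonneg _) (hint 1 1)).trans hlt
      have h4 : ‖k' 0 1 * (p : ℚ_[p]) ^ (n + 1)‖ ≤ ‖(p : ℚ_[p])‖ := by
        rw [norm_mul]
        exact (mul_le_of_le_one_left (norm_nonneg _) (hint 0 1)).trans hlt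
      have h5 := norm_sub_le_of_le (h2.trans h3) h4
      rw [add_sub_cancel_right, (norm_diag_eq_one hk' hc).1] at h5
      exact absurd norm_prime_lt_one (not_lt.2 h5)
  · right
    obtain ⟨hint, hdet⟩ := mem_stdStab_iff.1 hk
    have hlt : height e.snd < height e.fst := by
      rw [hv, hw, height_level hk, height_level hk]
      omega
    have hke : (k * (diagP p ^ m * flipP p)) • eStar p = e := by
      refine edge_ext ?_ ?_
      · rw [hv, edge_smul_fst, mul_smul, mul_smul]
        exact congrArg (k • ·) ((congrArg (diagP p ^ m • ·) flipP_smul.1).trans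
          (diagP_pow_smul_vHat m))
      · rw [hw, edge_smul_snd, mul_smul, mul_smul]
        exact congrArg (k • ·) (congrArg (diagP p ^ m • ·) flipP_smul.2)
    have hval : ((k * (diagP p ^ m * flipP p) : GL (Fin 2) ℚ_[p]) :
        Matrix (Fin 2) (Fin 2) ℚ_[p]) =
        !![k 0 1 * (p : ℚ_[p]) ^ (m + 1), -k 0 0; k 1 1 * (p : ℚ_[p]) ^ (m + 1), -k 1 0] := by
      rw [Units.val_mul, Units.val_mul, diagP_pow_val, flipP, mkOfDetNeZero_val]
      ext i j
      fin_cases i <;> fin_cases j <;> simp [Matrix.mul_apply, Fin.sum_univ_two, pow_succ]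
    -- The image of `0` is `k 0 0 / k 1 0`, which is not integral if `p ∣ k 1 0`, since then `k 0 0`
    -- is a unit. And `p ∣ k 1 0` is exactly the condition that `k` fix `v̂_*`.
    have hc : ¬ ‖k 1 0‖ < 1 := by
      intro hc
      have h2 := hA _ hke 0 (by simp)
      rw [OnePoint.smul_some_eq_ite, hval] at h2
      simp only [Matrix.of_apply, Matrix.cons_val', Matrix.cons_val_zero, Matrix.cons_val_one,
        Matrix.cons_val_fin_one, mul_zero, zero_add] at h2
      split_ifs at h2 with h0
      · exact absurd h2 infty_notMem_zpBall
      · rw [coe_mem_zpBall, norm_div, div_le_one₀ (norm_pos_iff.2 h0), norm_neg, norm_neg,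
          (norm_diag_eq_one hk hc).1] at h2
        exact absurd hc (not_lt.2 h2)
    have hb : ¬ Beyond e.fst := by
      rw [hv, beyond_iff hk, stdStab_smul_vHat_iff hk]
      exact hc
    exact ⟨hlt, hb, fun h => hb (h.of_parent e.adj hlt)⟩

open scoped Classical in
theorem smul_mem_zpBall {A : GL (Fin 2) ℚ_[p]} (hA : A • eStar p = eStar p) {t : OnePoint ℚ_[p]}
    (ht : t ∈ zpBall p) : A • t ∈ zpBall p := by
  obtain ⟨hA1, hA2⟩ := smul_eStar_eq_iff.1 hA
  obtain ⟨c, k, hk, rfl⟩ := exists_eq_scal_mul hA1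
  rw [mul_smul, scal_smul_vertex, stdStab_smul_vHat_iff hk] at hA2
  obtain ⟨x, hx, rfl⟩ := ht
  obtain ⟨hint, -⟩ := mem_stdStab_iff.1 hk
  have hval : ∀ i j, ((scal c * k : GL (Fin 2) ℚ_[p]) : Matrix (Fin 2) (Fin 2) ℚ_[p]) i j =
      c * k i j := fun i j => by
    rw [Units.val_mul, scal_val]
    simp
  have hden : ‖k 1 0 * x + k 1 1‖ = 1 := by
    have h1 : ‖k 1 0 * x‖ < 1 := by
      rw [norm_mul]
      exact mul_lt_one_of_nonneg_of_lt_one_left (norm_nonneg _) hA2 hx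
    rw [Padic.add_eq_max_of_ne (by rw [(norm_diag_eq_one hk hA2).2]; exact h1.ne),
      (norm_diag_eq_one hk hA2).2, max_eq_right h1.le]
  have hnum : ‖k 0 0 * x + k 0 1‖ ≤ 1 := by
    refine norm_add_le_of_le ?_ (hint 0 1)
    rw [norm_mul]
    exact mul_le_one₀ (hint 0 0) (norm_nonneg _) hx
  have hc : (c : ℚ_[p]) ≠ 0 := c.ne_zero
  have hden0 : k 1 0 * x + k 1 1 ≠ 0 := norm_pos_iff.1 (hden ▸ one_pos)
  have e1 : (c : ℚ_[p]) * k 1 0 * x + c * k 1 1 = c * (k 1 0 * x + k 1 1) := by ring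
  have e2 : (c : ℚ_[p]) * k 0 0 * x + c * k 0 1 = c * (k 0 0 * x + k 0 1) := by ring
  rw [OnePoint.smul_some_eq_ite]
  simp only [hval, e1, e2]
  rw [if_neg (mul_ne_zero hc hden0), coe_mem_zpBall, mul_div_mul_left _ _ hc, norm_div, hden,
    div_one]
  exact hnum

-- The stabilizer of `e_*` preserves `ℤ_p`, so the matrix carrying `e_*` to the edge may be chosen
-- freely.
open scoped Classical in
theorem ball_smul_eStar (A : GL (Fin 2) ℚ_[p]) :
    ball (A • eStar p) = (fun t => A • t) '' zpBall p := by
  ext x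
  constructor
  · rintro ⟨A', hA', t, ht, rfl⟩
    refine ⟨(A⁻¹ * A') • t, smul_mem_zpBall ?_ ht, ?_⟩
    · rw [edge_mul_smul, hA', ← edge_mul_smul, inv_mul_cancel, edge_one_smul]
    · change A • (A⁻¹ * A') • t = _
      rw [← mul_smul, mul_inv_cancel_left]
  · rintro ⟨t, ht, rfl⟩
    exact ⟨A, rfl, t, ht, by congr⟩

/-! ### Finitely additive measures are determined by their values on discs -/

/-- The disc `a + pⁿ ℤ_p`. -/
def disc (a : ℚ_[p]) (n : ℕ) : Set (OnePoint ℚ_[p]) :=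
  (fun x : ℚ_[p] => (x : OnePoint ℚ_[p])) '' Metric.closedBall a ‖(p : ℚ_[p]) ^ n‖

theorem norm_prime_pow_pos (n : ℕ) : 0 < ‖(p : ℚ_[p]) ^ n‖ :=
  norm_pos_iff.2 (pow_ne_zero _ (norm_pos_iff.1 norm_prime_pos))

theorem disc_eq_ball (a : ℚ_[p]) (n : ℕ) : ∃ e : Edge p, ball e = disc a n := by
  classical
  have hp : (p : ℚ_[p]) ^ n ≠ 0 := norm_pos_iff.1 (norm_prime_pow_pos n)
  have hd : (!![(p : ℚ_[p]) ^ n, a; 0, 1] : Matrix (Fin 2) (Fin 2) ℚ_[p]).det = (p : ℚ_[p]) ^ n := by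
    simp [Matrix.det_fin_two]
  set A : GL (Fin 2) ℚ_[p] := Matrix.GeneralLinearGroup.mkOfDetNeZero
    !![(p : ℚ_[p]) ^ n, a; 0, 1] (by rwa [hd]) with hA
  have hact : ∀ t : ℚ_[p], A • (t : OnePoint ℚ_[p]) = (((p : ℚ_[p]) ^ n * t + a : ℚ_[p])) := by
    intro t
    rw [OnePoint.smul_some_eq_ite, hA, mkOfDetNeZero_val]
    simp
  refine ⟨A • eStar p, ?_⟩
  rw [ball_smul_eStar]
  ext x
  constructor
  · rintro ⟨_, ⟨t, ht, rfl⟩, rfl⟩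
    refine ⟨(p : ℚ_[p]) ^ n * t + a, ?_, (hact t).symm⟩
    rw [mem_closedBall_iff_norm, add_sub_cancel_right, norm_mul]
    exact mul_le_of_le_one_right (norm_nonneg _) ht
  · rintro ⟨y, hy, rfl⟩
    rw [mem_closedBall_iff_norm] at hy
    refine ⟨(((y - a) / (p : ℚ_[p]) ^ n : ℚ_[p]) : OnePoint ℚ_[p]), coe_mem_zpBall.2 ?_, ?_⟩
    · rw [norm_div]
      exact div_le_one_of_le₀ hy (norm_nonneg _)
    · refine (hact _).trans ?_
      rw [mul_div_cancel₀ _ hp, sub_add_cancel]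

/-- The disc `a + pⁿ ℤ_p` as a compact open set. -/
def discCO (a : ℚ_[p]) (n : ℕ) : TopologicalSpace.CompactOpens (OnePoint ℚ_[p]) where
  carrier := disc a n
  isCompact' := (isCompact_closedBall a _).image OnePoint.continuous_coe
  isOpen' := OnePoint.isOpenEmbedding_coe.isOpenMap _
    (IsUltrametricDist.isOpen_closedBall a (norm_prime_pow_pos n).ne')

theorem Meas₀.val_bot (m : Meas₀ p) : m.val ⊥ = 0 := by
  have h := m.additive ⊥ ⊥ (by simp)
  rw [sup_bot_eq] at h
  omega

theorem mem_finset_sup_compactOpens {ι X : Type*} [TopologicalSpace X] (S : Finset ι)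
    (f : ι → TopologicalSpace.CompactOpens X) (x : X) :
    x ∈ ((S.sup f : TopologicalSpace.CompactOpens X) : Set X) ↔ ∃ i ∈ S, x ∈ (f i : Set X) := by
  simp

theorem Meas₀.val_finset_sup_congr (m m₀ : Meas₀ p) {ι : Type*} (S : Finset ι)
    (f : ι → TopologicalSpace.CompactOpens (OnePoint ℚ_[p]))
    (hdisj : ∀ i ∈ S, ∀ j ∈ S, i ≠ j → Disjoint (f i : Set (OnePoint ℚ_[p])) (f j))
    (h : ∀ i ∈ S, m.val (f i) = m₀.val (f i)) : m.val (S.sup f) = m₀.val (S.sup f) := by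
  classical
  induction S using Finset.induction_on with
  | empty => rw [Finset.sup_empty, m.val_bot, m₀.val_bot]
  | insert a S ha ih =>
    have hd : Disjoint (f a : Set (OnePoint ℚ_[p])) (S.sup f : TopologicalSpace.CompactOpens _) := by
      rw [Set.disjoint_left]
      intro x hx hx'
      obtain ⟨i, hi, hxi⟩ := (mem_finset_sup_compactOpens S f x).1 hx'
      exact Set.disjoint_left.1 (hdisj a (Finset.mem_insert_self _ _) i
        (Finset.mem_insert_of_mem hi) (by rintro rfl; exact ha hi)) hx hxi
    rw [Finset.sup_insert, m.additive _ _ hd, m₀.additive _ _ hd,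
      h a (Finset.mem_insert_self _ _), ih (fun i hi j hj => hdisj i (Finset.mem_insert_of_mem hi) j
        (Finset.mem_insert_of_mem hj)) (fun i hi => h i (Finset.mem_insert_of_mem hi))]

theorem norm_prime_pow_eq (n : ℕ) : ‖(p : ℚ_[p]) ^ n‖ = (p : ℝ) ^ (-(n : ℤ)) := by
  rw [norm_pow, Padic.norm_p, zpow_neg, zpow_natCast, inv_pow]

theorem exists_nat_norm_sub_le {x : ℚ_[p]} (hx : ‖x‖ ≤ 1) (n : ℕ) :
    ∃ i < p ^ n, ‖x - (i : ℚ_[p])‖ ≤ ‖(p : ℚ_[p]) ^ n‖ := by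
  obtain ⟨y, rfl⟩ : ∃ y : ℤ_[p], (y : ℚ_[p]) = x := ⟨⟨x, hx⟩, rfl⟩
  refine ⟨y.appr n, y.appr_lt n, ?_⟩
  have := (PadicInt.norm_le_pow_iff_mem_span_pow _ n).2 (PadicInt.appr_spec n y)
  rw [norm_prime_pow_eq]
  exact_mod_cast this

theorem disc_disjoint {n i j : ℕ} (hi : i < p ^ n) (hj : j < p ^ n) (hij : i ≠ j) :
    Disjoint (disc (i : ℚ_[p]) n) (disc (j : ℚ_[p]) n) := by
  rw [Set.disjoint_left]
  rintro _ ⟨x, hx, rfl⟩ ⟨y, hy, hyx⟩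
  rw [OnePoint.coe_injective hyx, mem_closedBall_iff_norm] at hy
  rw [mem_closedBall_iff_norm] at hx
  have h := norm_sub_le_of_le hy hx
  rw [sub_sub_sub_cancel_left, norm_prime_pow_eq] at h
  have h2 := (Padic.norm_int_le_pow_iff_dvd ((i : ℤ) - j) n).1 (by exact_mod_cast h)
  have h3 := Int.eq_zero_of_abs_lt_dvd h2 (by
    have hi' : (i : ℤ) < (p : ℤ) ^ n := by exact_mod_cast hi
    have hj' : (j : ℤ) < (p : ℤ) ^ n := by exact_mod_cast hj
    rw [abs_lt]
    constructor <;> omega)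
  omega

/-- A compact open subset of `ℤ_p` contains its own `δ`-thickening for some `δ > 0`. Hence it is a
union of residue classes mod `pⁿ` once `|p|ⁿ < δ`. -/
theorem exists_eq_sup_discCO {U : TopologicalSpace.CompactOpens (OnePoint ℚ_[p])}
    (hU : (U : Set (OnePoint ℚ_[p])) ⊆ zpBall p) :
    ∃ (n : ℕ) (S : Finset ℕ), (∀ i ∈ S, i < p ^ n) ∧ U = S.sup fun i => discCO (i : ℚ_[p]) n := by
  classical
  set K : Set ℚ_[p] := (fun x : ℚ_[p] => (x : OnePoint ℚ_[p])) ⁻¹' (U : Set (OnePoint ℚ_[p])) with hK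
  have himg : (fun x : ℚ_[p] => (x : OnePoint ℚ_[p])) '' K = (U : Set (OnePoint ℚ_[p])) := by
    rw [hK, Set.image_preimage_eq_iff]
    exact hU.trans (Set.image_subset_range _ _)
  have hKo : IsOpen K := U.isOpen.preimage OnePoint.continuous_coe
  have hKc : IsCompact K := by
    rw [OnePoint.isOpenEmbedding_coe.isInducing.isCompact_iff]
    exact himg ▸ U.isCompact
  obtain ⟨δ, hδ, hsub⟩ := hKc.exists_thickening_subset_open hKo subset_rfl
  obtain ⟨n, hn⟩ := exists_pow_lt_of_lt_one hδ (norm_prime_lt_one (p := p))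
  rw [← norm_pow] at hn
  have hnear : ∀ x y : ℚ_[p], x ∈ K → ‖x - y‖ ≤ ‖(p : ℚ_[p]) ^ n‖ → y ∈ K := by
    intro x y hx hxy
    refine hsub (Metric.mem_thickening_iff.2 ⟨x, hx, ?_⟩)
    rw [dist_comm, dist_eq_norm]
    exact hxy.trans_lt hn
  refine ⟨n, (Finset.range (p ^ n)).filter fun i : ℕ => (i : ℚ_[p]) ∈ K, fun i hi =>
    Finset.mem_range.1 (Finset.mem_filter.1 hi).1, ?_⟩
  refine SetLike.coe_injective (Set.ext fun x => ?_)
  rw [mem_finset_sup_compactOpens]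
  constructor
  · intro hx
    obtain ⟨y, hy, rfl⟩ := hU hx
    obtain ⟨i, hi, hyi⟩ := exists_nat_norm_sub_le hy n
    exact ⟨i, Finset.mem_filter.2 ⟨Finset.mem_range.2 hi, hnear y i hx hyi⟩, y,
      mem_closedBall_iff_norm.2 hyi, rfl⟩
  · rintro ⟨i, hi, y, hy, rfl⟩
    rw [mem_closedBall_iff_norm, norm_sub_rev] at hy
    exact hnear i y (Finset.mem_filter.1 hi).2 hy

theorem disc_subset_zpBall (i n : ℕ) : disc (i : ℚ_[p]) n ⊆ zpBall p := by
  rintro _ ⟨y, hy, rfl⟩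
  rw [mem_closedBall_iff_norm] at hy
  refine coe_mem_zpBall.2 ?_
  have h1 : ‖((i : ℤ) : ℚ_[p])‖ ≤ 1 := Padic.norm_int_le_one i
  have h2 := norm_add_le_of_le (hy.trans (by
    rw [norm_pow]
    exact pow_le_one₀ (norm_nonneg _) norm_prime_lt_one.le)) (by simpa using h1 : ‖(i : ℚ_[p])‖ ≤ 1)
  rwa [sub_add_cancel] at h2

theorem Meas₀.val_eq_of_corresponds {m m₀ : Meas₀ p} {c c₀ : Edge p → ℤ} (hm : Corresponds m c)
    (hm₀ : Corresponds m₀ c₀) (h : ∀ e : Edge p, ball e ⊆ zpBall p → c e = c₀ e)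
    {U : TopologicalSpace.CompactOpens (OnePoint ℚ_[p])}
    (hU : (U : Set (OnePoint ℚ_[p])) ⊆ zpBall p) : m.val U = m₀.val U := by
  obtain ⟨n, S, hS, rfl⟩ := exists_eq_sup_discCO hU
  refine m.val_finset_sup_congr m₀ S _
    (fun i hi j hj hij => disc_disjoint (hS i hi) (hS j hj) hij) fun i _ => ?_
  obtain ⟨e, he⟩ := disc_eq_ball (i : ℚ_[p]) n
  rw [hm e _ he.symm, hm₀ e _ he.symm]
  exact h e (he ▸ disc_subset_zpBall i n)

end Balls

/-! ### The local embedding of the arithmetic groups -/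

section Local

variable {p : ℕ} [Fact p.Prime] {a b : ℚ}
  (ι : ℚ_[p] ⊗[ℚ] ℍ[ℚ,a,b] ≃ₐ[ℚ_[p]] Matrix (Fin 2) (Fin 2) ℚ_[p])

theorem loc_injective : Function.Injective (loc ι) :=
  ι.injective.comp (Algebra.TensorProduct.includeRight_injective (algebraMap ℚ ℚ_[p]).injective)

theorem loc_algebraMap (r : ℚ) :
    loc ι (algebraMap ℚ ℍ[ℚ,a,b] r) = (r : ℚ_[p]) • (1 : Matrix (Fin 2) (Fin 2) ℚ_[p]) := by
  have h : (loc ι).comp (algebraMap ℚ ℍ[ℚ,a,b]) =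
      (algebraMap ℚ_[p] (Matrix (Fin 2) (Fin 2) ℚ_[p])).comp (algebraMap ℚ ℚ_[p]) :=
    Subsingleton.elim _ _
  refine (RingHom.congr_fun h r).trans ?_
  rw [RingHom.comp_apply, Algebra.algebraMap_eq_smul_one, eq_ratCast]

variable {ι} in
theorem locGL_val (u : (ℍ[ℚ,a,b])ˣ) :
    ((locGL ι u : GL (Fin 2) ℚ_[p]) : Matrix (Fin 2) (Fin 2) ℚ_[p]) = loc ι (u : ℍ[ℚ,a,b]) := rfl

theorem eq_algebraMap_of_central (ha : a ≠ 0) {x : ℍ[ℚ,a,b]}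
    (h : ∀ y, x * y = y * x) : x = algebraMap ℚ ℍ[ℚ,a,b] x.re := by
  have hi := h ⟨0, 1, 0, 0⟩
  have hj := h ⟨0, 0, 1, 0⟩
  rw [QuaternionAlgebra.ext_iff] at hi hj
  simp only [QuaternionAlgebra.re_mul, QuaternionAlgebra.imI_mul, QuaternionAlgebra.imJ_mul,
    QuaternionAlgebra.imK_mul] at hi hj
  obtain ⟨-, -, hi3, hi4⟩ := hi
  obtain ⟨-, hj2, -, -⟩ := hj
  have h1 : x.imK = 0 := by
    have : a * x.imK = 0 := by linarith
    exact (mul_eq_zero.1 this).resolve_left ha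
  have h2 : x.imJ = 0 := by linarith
  have h3 : x.imI = 0 := by
    have hj4 := congrArg QuaternionAlgebra.imK (h ⟨0, 0, 1, 0⟩)
    simp only [QuaternionAlgebra.imK_mul] at hj4
    linarith
  rw [QuaternionAlgebra.coe_algebraMap]
  ext <;> simp [h1, h2, h3]

/-- With `t` the reduced trace of `x`, the image `X` satisfies `X (t - X) = 1`. If `t` is the matrix
trace, the determinant is read off directly. Otherwise `X` must be scalar, so `x` is central, hence
rational with square 1. -/
theorem det_loc (ha : a ≠ 0) {x : ℍ[ℚ,a,b]} (hx : nrd x = 1) :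
    (loc ι x).det = 1 := by
  set X := loc ι x with hX
  obtain ⟨t, ht⟩ : ∃ t : ℚ, x + star x = algebraMap ℚ ℍ[ℚ,a,b] t :=
    ⟨_, QuaternionAlgebra.self_add_star' x⟩
  have h1 : X * loc ι (star x) = 1 := by
    rw [hX, ← map_mul, mul_star_eq_nrd, hx, map_one, map_one]
  have h2 : loc ι (star x) = (t : ℚ_[p]) • 1 - X := by
    rw [← loc_algebraMap ι, ← ht, map_add, hX, add_sub_cancel_left]
  rw [h2] at h1
  have e00 := congrFun (congrFun h1 0) 0
  have e01 := congrFun (congrFun h1 0) 1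
  have e10 := congrFun (congrFun h1 1) 0
  have e11 := congrFun (congrFun h1 1) 1
  simp only [Matrix.mul_apply, Fin.sum_univ_two, Matrix.sub_apply, Matrix.smul_apply,
    Matrix.one_apply_eq, smul_eq_mul, mul_one, ne_eq, zero_ne_one, not_false_eq_true,
    Matrix.one_apply_ne, mul_zero, zero_sub, one_ne_zero] at e00 e01 e10 e11
  rw [Matrix.det_fin_two]
  by_cases htr : (t : ℚ_[p]) = X 0 0 + X 1 1
  · rw [htr] at e00
    linear_combination e00
  · have hne : (t : ℚ_[p]) - X 0 0 - X 1 1 ≠ 0 := fun h => htr (by linear_combination h)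
    have h01 : X 0 1 = 0 := by
      refine (mul_eq_zero.1 (?_ : X 0 1 * ((t : ℚ_[p]) - X 0 0 - X 1 1) = 0)).resolve_right hne
      linear_combination e01
    have h10 : X 1 0 = 0 := by
      refine (mul_eq_zero.1 (?_ : X 1 0 * ((t : ℚ_[p]) - X 0 0 - X 1 1) = 0)).resolve_right hne
      linear_combination e10
    have hdiag : X 0 0 = X 1 1 := by
      refine sub_eq_zero.1 ((mul_eq_zero.1
        (?_ : (X 0 0 - X 1 1) * ((t : ℚ_[p]) - X 0 0 - X 1 1) = 0)).resolve_right hne)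
      linear_combination e00 - e11
    have hscal : X = X 0 0 • (1 : Matrix (Fin 2) (Fin 2) ℚ_[p]) := by
      ext i j
      fin_cases i <;> fin_cases j <;> simp [h01, h10, hdiag]
    have hcen : ∀ y, x * y = y * x := fun y => loc_injective ι (by
      rw [map_mul, map_mul, ← hX, hscal]
      simp)
    have hre := eq_algebraMap_of_central ha hcen
    have hXre : X = (x.re : ℚ_[p]) • (1 : Matrix (Fin 2) (Fin 2) ℚ_[p]) := by
      rw [← loc_algebraMap ι, ← hre]
    have hn : x.re * x.re = 1 := by
      rw [← hx, hre, nrd]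
      simp
    have hn' : (x.re : ℚ_[p]) * x.re = 1 := by exact_mod_cast hn
    rw [hXre]
    simpa using hn'

theorem IsEichlerOrder.toIntSubmodule_fg {R₀ : Subring ℍ[ℚ,a,b]} {M : ℕ} (h : IsEichlerOrder R₀ M) :
    (AddSubgroup.toIntSubmodule R₀.toAddSubgroup).FG := by
  obtain ⟨O₁, O₂, h₁, -, rfl, -⟩ := h
  have hfg : (AddSubgroup.toIntSubmodule O₁.toAddSubgroup).FG := by
    rw [Submodule.fg_iff_addSubgroup_fg]
    exact h₁.isOrder.fg
  exact hfg.of_le fun x hx => hx.1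

variable {ι} in
/-- An element of `O[1/p]` that is integral at `p` belongs to `O`. -/
theorem mem_of_mem_invertP {O : Subring ℍ[ℚ,a,b]}
    (hfg : (AddSubgroup.toIntSubmodule O.toAddSubgroup).FG) (hι : IsStandardAt ι O)
    {x : ℍ[ℚ,a,b]} (hx : x ∈ invertP p O) (hint : ∀ i j, ‖loc ι x i j‖ ≤ 1) : x ∈ O := by
  classical
  set N : Submodule ℤ ℍ[ℚ,a,b] := AddSubgroup.toIntSubmodule O.toAddSubgroup with hN
  have : Module.Finite ℤ N := Module.Finite.iff_fg.2 hfg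
  have : Module.IsTorsionFree ℤ ℍ[ℚ,a,b] := Module.IsTorsionFree.trans ℚ
  let β := Module.Free.chooseBasis ℤ N
  have hindZ : LinearIndependent ℤ fun i => (β i : ℍ[ℚ,a,b]) :=
    β.linearIndependent.map' N.subtype (Submodule.ker_subtype N)
  have hindQ : LinearIndependent ℚ fun i => (β i : ℍ[ℚ,a,b]) :=
    (LinearIndependent.iff_fractionRing ℤ ℚ).1 hindZ
  have hcard := hindQ.fintype_card_le_finrank
  rw [QuaternionAlgebra.finrank_eq_four] at hcard
  let w := fun i => loc ι (β i : ℍ[ℚ,a,b])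
  have hloc : ∀ y ∈ O, ∃ n : _ → ℤ, y = ∑ i, n i • (β i : ℍ[ℚ,a,b]) := by
    intro y hy
    refine ⟨fun i => β.repr ⟨y, hy⟩ i, ?_⟩
    have h1 := congrArg N.subtype (β.sum_repr ⟨y, hy⟩)
    rw [map_sum] at h1
    exact h1.symm
  have hlocw : ∀ n : _ → ℤ, loc ι (∑ i, n i • (β i : ℍ[ℚ,a,b])) = ∑ i, (n i : ℚ_[p]) • w i := by
    intro n
    rw [map_sum]
    refine Finset.sum_congr rfl fun i _ => ?_
    rw [map_zsmul, Int.cast_smul_eq_zsmul]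
  have hspan : Submodule.span ℤ_[p] (loc ι '' (O : Set ℍ[ℚ,a,b])) ≤
      Submodule.span ℤ_[p] (Set.range w) := by
    rw [Submodule.span_le]
    rintro _ ⟨y, hy, rfl⟩
    obtain ⟨n, rfl⟩ := hloc y hy
    rw [hlocw]
    refine Submodule.sum_mem _ fun i _ => ?_
    have : (n i : ℚ_[p]) • w i = (n i : ℤ_[p]) • w i := by
      rw [Int.cast_smul_eq_zsmul, Int.cast_smul_eq_zsmul]
    rw [this]
    exact Submodule.smul_mem _ _ (Submodule.subset_span ⟨i, rfl⟩)
  have hmem : ∀ A : Matrix (Fin 2) (Fin 2) ℚ_[p], (∀ i j, ‖A i j‖ ≤ 1) →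
      A ∈ Submodule.span ℤ_[p] (Set.range w) := fun A hA => hspan (by
    have : A ∈ (Submodule.span ℤ_[p] (loc ι '' (O : Set ℍ[ℚ,a,b])) :
      Set (Matrix (Fin 2) (Fin 2) ℚ_[p])) := by rw [hι]; exact hA
    exact this)
  -- The `w i` generate `M₂(ℤ_p)` over `ℤ_p`, in particular the matrix units. As there are at most
  -- four of them, they form a `ℚ_p`-basis of `M₂(ℚ_p)`, and coordinates can be compared.
  have htop : ⊤ ≤ Submodule.span ℚ_[p] (Set.range w) := by
    rintro A -
    rw [Matrix.matrix_eq_sum_single A]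
    refine Submodule.sum_mem _ fun i _ => Submodule.sum_mem _ fun j _ => ?_
    have h1 : Matrix.single i j (A i j) = A i j • Matrix.single i j (1 : ℚ_[p]) := by simp
    rw [h1]
    refine Submodule.smul_mem _ _ (Submodule.span_le_restrictScalars ℤ_[p] ℚ_[p] _ (hmem _ ?_))
    intro i' j'
    rw [Matrix.single_apply]
    split_ifs <;> simp
  have hfin : Module.finrank ℚ_[p] (Matrix (Fin 2) (Fin 2) ℚ_[p]) = 4 := by
    rw [Module.finrank_matrix]
    simp
  have hcard' : Fintype.card (Module.Free.ChooseBasisIndex ℤ N) =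
      Module.finrank ℚ_[p] (Matrix (Fin 2) (Fin 2) ℚ_[p]) := by
    refine le_antisymm (hfin ▸ hcard) ?_
    have h1 := finrank_range_le_card (R := ℚ_[p]) w
    rwa [Set.finrank, top_le_iff.1 htop, finrank_top] at h1
  have hindw : LinearIndependent ℚ_[p] w :=
    linearIndependent_of_top_le_span_of_card_eq_finrank htop hcard'
  obtain ⟨k, hk⟩ := hx
  obtain ⟨n, hn⟩ := hloc _ hk
  obtain ⟨z, hz⟩ := (Submodule.mem_span_range_iff_exists_fun ℤ_[p]).1 (hmem _ hint)
  -- `pᵏ x` has integer coordinates `n i`, and `x` itself has `p`-adic integral ones `z i`. So `pᵏ`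
  -- divides each `n i` in `ℤ`, and the quotients are coordinates of `x`.
  have hcoef : ∀ i, (n i : ℚ_[p]) = (p : ℚ_[p]) ^ k * (z i : ℚ_[p]) := by
    have h1 : ∑ i, (n i : ℚ_[p]) • w i = ∑ i, ((p : ℚ_[p]) ^ k * (z i : ℚ_[p])) • w i := by
      rw [← hlocw, ← hn, map_nsmul, ← hz, Finset.smul_sum]
      refine Finset.sum_congr rfl fun i _ => ?_
      rw [mul_smul, ← Nat.cast_pow, Nat.cast_smul_eq_nsmul]
      rfl
    have h2 : ∑ i, ((n i : ℚ_[p]) - (p : ℚ_[p]) ^ k * (z i : ℚ_[p])) • w i = 0 := by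
      simp only [sub_smul, Finset.sum_sub_distrib, h1, sub_self]
    exact fun i => sub_eq_zero.1 (Fintype.linearIndependent_iff.1 hindw _ h2 i)
  have hdvd : ∀ i, ∃ m : ℤ, n i = (p : ℤ) ^ k * m := by
    intro i
    refine (Padic.norm_int_le_pow_iff_dvd (n i) k).1 ?_
    rw [hcoef, norm_mul, ← norm_prime_pow_eq]
    exact mul_le_of_le_one_right (norm_nonneg _) (z i).2
  choose m hm using hdvd
  have hx : x = ∑ i, m i • (β i : ℍ[ℚ,a,b]) := by
    have h1 : (p ^ k) • x = (p ^ k) • ∑ i, m i • (β i : ℍ[ℚ,a,b]) := by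
      rw [hn, Finset.smul_sum]
      refine Finset.sum_congr rfl fun i _ => ?_
      rw [hm, mul_smul, ← Nat.cast_pow, natCast_zsmul]
    rw [← Nat.cast_smul_eq_nsmul ℚ, ← Nat.cast_smul_eq_nsmul ℚ (p ^ k)] at h1
    exact smul_right_injective _ (Nat.cast_ne_zero.2
      (pow_ne_zero k (Fact.out : p.Prime).ne_zero)) h1
  rw [hx]
  exact O.sum_mem fun i _ => O.zsmul_mem (β i).2 _

/-! ### Stabilizers of `v_*` and `e_*` in the arithmetic groups -/

variable {ι} {R₀ : Subring ℍ[ℚ,a,b]}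

theorem norm_det_locGL (ha : a ≠ 0) {O : Subring ℍ[ℚ,a,b]} {u : (ℍ[ℚ,a,b])ˣ}
    (hu : u ∈ normOneUnits O) :
    ‖((locGL ι u : GL (Fin 2) ℚ_[p]) : Matrix (Fin 2) (Fin 2) ℚ_[p]).det‖ = 1 := by
  rw [locGL_val, det_loc ι ha hu.2.2, norm_one]

theorem mem_stdStab_of_smul_vStar {A : GL (Fin 2) ℚ_[p]}
    (hd : ‖(A : Matrix (Fin 2) (Fin 2) ℚ_[p]).det‖ = 1) (hA : A • vStar p = vStar p) :
    A ∈ stdStab p := by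
  obtain ⟨c, k, hk, rfl⟩ := exists_eq_scal_mul hA
  rw [Units.val_mul, Matrix.det_mul, norm_mul, norm_det_scal, (mem_stdStab_iff.1 hk).2,
    mul_one] at hd
  exact mul_mem (scal_mem_stdStab ((pow_eq_one_iff_of_nonneg (norm_nonneg _) two_ne_zero).1 hd)) hk

/-- Fixing `v_*` with determinant 1 means lying in `GL₂(ℤ_p)`, which brings an element of `R₀[1/p]`
back into `R₀`; fixing `v̂_*` as well is the upper triangular condition mod `p`. The inverse is
treated in the same way. -/
theorem mem_gammaPM_of_smul_eStar (ha : a ≠ 0)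
    (hfg : (AddSubgroup.toIntSubmodule R₀.toAddSubgroup).FG) (hι : IsStandardAt ι R₀)
    {u : (ℍ[ℚ,a,b])ˣ} (hu : u ∈ bigGamma p R₀) (h : locGL ι u • eStar p = eStar p) :
    u ∈ gammaPM ι R₀ := by
  have key : ∀ {u : (ℍ[ℚ,a,b])ˣ}, u ∈ bigGamma p R₀ → locGL ι u • eStar p = eStar p →
      (u : ℍ[ℚ,a,b]) ∈ levelP ι R₀ := by
    intro u hu h
    obtain ⟨h1, h2⟩ := smul_eStar_eq_iff.1 h
    have hk := mem_stdStab_of_smul_vStar (norm_det_locGL ha hu) h1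
    have hint := (mem_stdStab_iff.1 hk).1
    exact ⟨mem_of_mem_invertP hfg hι hu.1 hint, hint, (stdStab_smul_vHat_iff hk).1 h2⟩
  refine ⟨key hu h, key (inv_mem hu) ?_, hu.2.2⟩
  nth_rw 1 [← h]
  rw [← edge_mul_smul, ← map_mul, inv_mul_cancel, map_one, edge_one_smul]

theorem gammaPM_smul_eStar (ha : a ≠ 0) {u : (ℍ[ℚ,a,b])ˣ}
    (hu : u ∈ gammaPM ι R₀) : locGL ι u • eStar p = eStar p := by
  obtain ⟨-, hint, hc⟩ := hu.1
  have hk : locGL ι u ∈ stdStab p := mem_stdStab_iff.2 ⟨hint, norm_det_locGL ha hu⟩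
  exact smul_eStar_eq_iff.2 ⟨stdStab_smul_vStar hk, (stdStab_smul_vHat_iff hk).2 hc⟩

omit [Fact p.Prime] in
theorem normOneUnits_le_bigGamma : normOneUnits R₀ ≤ bigGamma p R₀ := by
  rintro u ⟨h1, h2, h3⟩
  exact ⟨⟨0, by simpa using h1⟩, ⟨0, by simpa using h2⟩, h3⟩

theorem normOneUnits_smul_vStar (ha : a ≠ 0) (hι : IsStandardAt ι R₀)
    {u : (ℍ[ℚ,a,b])ˣ} (hu : u ∈ normOneUnits R₀) : locGL ι u • vStar p = vStar p := by
  refine stdStab_smul_vStar (mem_stdStab_iff.2 ⟨?_, norm_det_locGL ha hu⟩)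
  have h : loc ι u ∈ (Submodule.span ℤ_[p] (loc ι '' (R₀ : Set ℍ[ℚ,a,b])) :
      Set (Matrix (Fin 2) (Fin 2) ℚ_[p])) := Submodule.subset_span ⟨u, hu.1, rfl⟩
  rw [hι] at h
  exact h

theorem upsilon_notMem_gammaPM {γ : Fin (p + 1) → (ℍ[ℚ,a,b])ˣ} (hγ : IsUpsilon ι R₀ γ)
    {i : Fin (p + 1)} (hi : i ≠ 0) : γ i ∉ gammaPM ι R₀ := by
  intro h
  obtain ⟨j, -, hj⟩ := hγ.representatives _ (hγ.mem i)
  refine hi ((hj i ?_).trans (hj 0 ?_).symm)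
  · change γ i * (γ i)⁻¹ ∈ _
    rw [mul_inv_cancel]
    exact one_mem _
  · change γ i * (γ 0)⁻¹ ∈ _
    rwa [hγ.zero, inv_one, mul_one]

theorem upsilon_ne_one {γ : Fin (p + 1) → (ℍ[ℚ,a,b])ˣ} (hγ : IsUpsilon ι R₀ γ)
    {i : Fin (p + 1)} (hi : i ≠ 0) : γ i ≠ 1 := fun h =>
  upsilon_notMem_gammaPM hγ hi (h ▸ one_mem _)

theorem locGL_omega_smul {ω : (ℍ[ℚ,a,b])ˣ} (hω : IsOmega ι R₀ ω) :
    locGL ι ω • vStar p = vHat p ∧ locGL ι ω • vHat p = vStar p := by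
  obtain ⟨u, ⟨⟨hint, hc⟩, hd⟩, hu⟩ := hω.local_form
  set U : GL (Fin 2) ℚ_[p] := Matrix.GeneralLinearGroup.mkOfDetNeZero u
    (by rw [hd]; exact one_ne_zero) with hU
  have h1 : locGL ι ω = U * flipP p := Units.ext hu
  have hk : U ∈ stdStab p := mem_stdStab_iff.2 ⟨hint, (congrArg norm hd).trans norm_one⟩
  rw [h1, mul_smul, mul_smul, flipP_smul.1, flipP_smul.2]
  exact ⟨(stdStab_smul_vHat_iff hk).2 hc, stdStab_smul_vStar hk⟩

theorem locGL_scalarP : locGL ι (scalarP p a b) = scal (primeUnit p) := by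
  refine Units.ext ?_
  rw [scal_val]
  refine (loc_algebraMap ι _).trans ?_
  simp [primeUnit]

theorem tildeGamma_ne_one (ha : a ≠ 0)
    (hfg : (AddSubgroup.toIntSubmodule R₀.toAddSubgroup).FG) (hι : IsStandardAt ι R₀)
    {γ : Fin (p + 1) → (ℍ[ℚ,a,b])ˣ} (hγ : IsUpsilon ι R₀ γ) {ω : (ℍ[ℚ,a,b])ˣ}
    (hω : IsOmega ι R₀ ω) {i : Fin (p + 1)} (hi : i ≠ 0) : tildeGamma ω γ i ≠ 1 := by
  intro h
  rw [tildeGamma, if_neg hi] at h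
  have h1 : ω * (γ i * ω) = scalarP p a b := by
    rw [mul_assoc, mul_assoc, inv_mul_eq_one] at h
    exact h.symm
  refine upsilon_notMem_gammaPM hγ hi (mem_gammaPM_of_smul_eStar ha hfg hι
    (normOneUnits_le_bigGamma (hγ.mem i))
    (smul_eStar_eq_iff.2 ⟨normOneUnits_smul_vStar ha hι (hγ.mem i), ?_⟩))
  -- If `ω γ_i ω = p`, then, `ω` exchanging `v_*` and `v̂_*`, `γ_i` fixes `v̂_*`. It fixes `v_*`
  -- too, so it would lie in `Γ₀ᴰ(pM)`.
  have h2 : locGL ι (ω * (γ i * ω)) • vStar p = vStar p := by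
    rw [h1, locGL_scalarP, scal_smul_vertex]
  rw [map_mul, map_mul, mul_smul, mul_smul, (locGL_omega_smul hω).1] at h2
  exact smul_left_cancel _ (h2.trans (locGL_omega_smul hω).2.symm)

end Local

/-! ### The radial system and alternating words -/

section Words

variable {p : ℕ} [Fact p.Prime] {a b : ℚ}
  {ι : ℚ_[p] ⊗[ℚ] ℍ[ℚ,a,b] ≃ₐ[ℚ_[p]] Matrix (Fin 2) (Fin 2) ℚ_[p]}
  {R₀ : Subring ℍ[ℚ,a,b]} {ω : (ℍ[ℚ,a,b])ˣ} {γ : Fin (p + 1) → (ℍ[ℚ,a,b])ˣ}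
  {γE : Edge p → (ℍ[ℚ,a,b])ˣ} {γV : Vertex p → (ℍ[ℚ,a,b])ˣ}

theorem isEven_iff {v : Vertex p} : v.IsEven ↔ Even (height v) := Iff.rfl

theorem isEven_adj {v w : Vertex p} (h : (tree p).Adj v w) : v.IsEven ↔ ¬ w.IsEven := by
  rw [isEven_iff, isEven_iff]
  rcases height_adj h with h | h <;> rw [h, Nat.even_add_one]
  exact not_not.symm

theorem evenEdge_iff_snd {e : Edge p} : EvenEdge e ↔ ¬ Vertex.IsEven e.snd := isEven_adj e.adj

theorem evenEdge_symm_iff {e : Edge p} : EvenEdge e.symm ↔ ¬ EvenEdge e := by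
  rw [evenEdge_iff_snd (e := e), not_not]
  rfl

theorem inward_iff {e : Edge p} : Inward e ↔ height e.fst = height e.snd + 1 := by
  have h : Inward e ↔ height e.snd < height e.fst := Iff.rfl
  rw [h]
  rcases height_adj e.adj with h | h <;> omega

theorem outward_iff {e : Edge p} : Outward e ↔ height e.snd = height e.fst + 1 := by
  have h : Outward e ↔ height e.fst < height e.snd := Iff.rfl
  rw [h]
  rcases height_adj e.adj with h | h <;> omega

theorem inward_or_outward (e : Edge p) : Inward e ∨ Outward e := by
  rw [inward_iff, outward_iff]
  exact (height_adj e.adj).symm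

theorem Inward.eq {e f : Edge p} (he : Inward e) (hf : Inward f) (h : e.fst = f.fst) : e = f := by
  refine edge_ext h (eq_of_adj_of_height_lt e.adj ?_ he ?_)
  · rw [h]; exact f.adj
  · rw [h]; exact hf

theorem Outward.eq {e f : Edge p} (he : Outward e) (hf : Outward f) (h : e.snd = f.snd) :
    e = f := by
  refine edge_ext (eq_of_adj_of_height_lt e.adj.symm ?_ he ?_) h
  · rw [h]; exact f.adj.symm
  · rw [h]; exact hf

theorem outward_eStar : Outward (eStar p) := by
  change height (vStar p) < height (vHat p)
  rw [height_vStar, height_vHat]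
  exact one_pos

theorem evenEdge_eStar : EvenEdge (eStar p) := by
  change Even (height (vStar p))
  rw [height_vStar]
  exact Even.zero

/-! ### Radial systems as sets of alternating words -/

theorem IsRadialSystem.eq_of_eq (hY : IsRadialSystem ι R₀ ω γ γE γV) {e f : Edge p}
    (he : EvenEdge e) (hf : EvenEdge f) (h : γE e = γE f) : e = f := by
  rw [← hY.representsE e he, h, hY.representsE f hf]

theorem IsRadialSystem.eStar_eq (hY : IsRadialSystem ι R₀ ω γ γE γV) : γE (eStar p) = 1 := by
  rw [← hY.outward_eq _ evenEdge_eStar outward_eStar]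
  exact hY.vHat_eq

theorem IsRadialSystem.source_exists (hY : IsRadialSystem ι R₀ ω γ γE γV) {v : Vertex p}
    (hv : v.IsEven) (i : Fin (p + 1)) : ∃ e : Edge p, e.fst = v ∧ γE e = γ i * γV v := by
  have h : γ i * γV v ∈ γE '' {e | e.fst = v} := by
    rw [hY.source_eq v hv]
    exact ⟨i, rfl⟩
  exact h

theorem IsRadialSystem.target_exists (hY : IsRadialSystem ι R₀ ω γ γE γV) {v : Vertex p}
    (hv : ¬ v.IsEven) (i : Fin (p + 1)) :
    ∃ e : Edge p, e.snd = v ∧ γE e = tildeGamma ω γ i * γV v := by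
  have h : tildeGamma ω γ i * γV v ∈ γE '' {e | e.snd = v} := by
    rw [hY.target_eq v hv]
    exact ⟨i, rfl⟩
  exact h

theorem IsRadialSystem.exists_index_source (hY : IsRadialSystem ι R₀ ω γ γE γV) {e : Edge p}
    (he : EvenEdge e) : ∃ i, γE e = γ i * γV e.fst := by
  have h : γE e ∈ γE '' {f | f.fst = e.fst} := ⟨e, rfl, rfl⟩
  rw [hY.source_eq e.fst he] at h
  obtain ⟨i, hi⟩ := h
  exact ⟨i, hi.symm⟩

theorem IsRadialSystem.exists_index_target (hY : IsRadialSystem ι R₀ ω γ γE γV) {e : Edge p}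
    (he : EvenEdge e) : ∃ i, γE e = tildeGamma ω γ i * γV e.snd := by
  have h : γE e ∈ γE '' {f | f.snd = e.snd} := ⟨e, rfl, rfl⟩
  rw [hY.target_eq e.snd (evenEdge_iff_snd.1 he)] at h
  obtain ⟨i, hi⟩ := h
  exact ⟨i, hi.symm⟩

/-- Alternating words with nonzero indices are elements of the radial system. -/
theorem IsRadialSystem.exists_edge_of_word (hY : IsRadialSystem ι R₀ ω γ γE γV)
    (hγ : ∀ i, i ≠ 0 → γ i ≠ 1) (hγt : ∀ i, i ≠ 0 → tildeGamma ω γ i ≠ 1)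
    (l : List (Fin (p + 1))) (hl : ∀ i ∈ l, i ≠ 0) :
    (∃ e, EvenEdge e ∧ Outward e ∧ γE e = altProd ω γ false l) ∧
      (l ≠ [] → ∃ e, EvenEdge e ∧ Inward e ∧ γE e = altProd ω γ true l) := by
  induction l with
  | nil => exact ⟨⟨eStar p, evenEdge_eStar, outward_eStar, hY.eStar_eq⟩, fun h => absurd rfl h⟩
  | cons i l ih =>
    have hi : i ≠ 0 := hl i List.mem_cons_self
    obtain ⟨⟨f, hf, hfo, hfl⟩, ih'⟩ := ih fun j hj => hl j (List.mem_cons_of_mem _ hj)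
    refine ⟨?_, fun _ => ?_⟩
    · by_cases hnil : l = []
      · subst hnil
        have hv : (vStar p).IsEven := evenEdge_eStar
        obtain ⟨e, he, hei⟩ := hY.source_exists hv i
        rw [hY.vStar_eq, mul_one] at hei
        refine ⟨e, ?_, ?_, by rw [hei, altProd, altProd, mul_one]⟩
        · change Vertex.IsEven e.fst
          rwa [he]
        · rcases inward_or_outward e with h | h
          · rw [inward_iff, he, height_vStar] at h
            omega
          · exact h
      · obtain ⟨g, hg, hgi, hgl⟩ := ih' hnil
        obtain ⟨e, he, hei⟩ := hY.source_exists hg i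
        rw [hY.inward_eq g hg hgi] at hei
        have hee : EvenEdge e := by
          change Vertex.IsEven e.fst
          rw [he]
          exact hg
        -- The new edge shares its source with the inward edge `g`. Were it inward as well, it would
        -- equal `g`, and `γ_e = γ_i γ_g` would force `γ_i = 1`. The case of `γ̃_i` is the mirror
        -- image, with targets and outward edges.
        refine ⟨e, hee, (inward_or_outward e).resolve_left fun h => hγ i hi ?_,
          by rw [hei, hgl, altProd]⟩
        rw [h.eq hgi he] at hei
        exact right_eq_mul.1 hei
    · have hv : ¬ Vertex.IsEven f.snd := evenEdge_iff_snd.1 hf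
      obtain ⟨e, he, hei⟩ := hY.target_exists hv i
      rw [hY.outward_eq f hf hfo] at hei
      have hee : EvenEdge e := by
        rw [evenEdge_iff_snd, he]
        exact hv
      refine ⟨e, hee, (inward_or_outward e).resolve_right fun h => hγt i hi ?_,
        by rw [hei, hfl, altProd]⟩
      rw [h.eq hfo he] at hei
      exact right_eq_mul.1 hei

theorem tildeGamma_zero : tildeGamma ω γ 0 = 1 := if_pos rfl

/-- The product of `γ_e` with an alternating word starting with a `γ̃` is an alternating word,
provided that the word is empty or that `e` is not behind `v̂_*`. -/
theorem IsRadialSystem.exists_word_mul (hY : IsRadialSystem ι R₀ ω γ γE γV) (hγ0 : γ 0 = 1)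
    {L : List (Fin (p + 1))} (hL : ∀ i ∈ L, i ≠ 0) (n : ℕ) :
    ∀ e : Edge p, height e.fst + height e.snd ≤ n → EvenEdge e →
      (L = [] ∨ ¬ Beyond e.fst ∧ ¬ Beyond e.snd) →
      (Inward e → ∃ l, l ≠ [] ∧ (∀ i ∈ l, i ≠ 0) ∧
        γE e * altProd ω γ true L = altProd ω γ true l) ∧
      (Outward e → e ≠ eStar p → ∃ l, (∀ i ∈ l, i ≠ 0) ∧
        γE e * altProd ω γ true L = altProd ω γ false l) := by
  induction n with
  | zero =>
    intro e hn
    rcases height_adj e.adj with h | h <;> omega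
  | succ n ih =>
    intro e hn he hLe
    refine ⟨fun hin => ?_, fun hout hne => ?_⟩
    · have hodd : ¬ Vertex.IsEven e.snd := evenEdge_iff_snd.1 he
      obtain ⟨u, hadj, hu⟩ := exists_parent (v := e.snd) (by
        intro h
        rw [h] at hodd
        exact hodd evenEdge_eStar)
      -- The last edge on the path from `v_*` to the odd vertex `e.snd`. It is outward and has the
      -- same target as `e`, so `γ_e = γ̃_i γ_f`. An index `i = 0` would give `e = f`, although
      -- their sources have different heights.
      let f : Edge p := ⟨(u, e.snd), hadj.symm⟩
      have hf : EvenEdge f := evenEdge_iff_snd.2 hodd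
      have hfo : Outward f := outward_iff.2 hu
      have hin' := inward_iff.1 hin
      obtain ⟨i, hi⟩ := hY.exists_index_target he
      have hfV : γV e.snd = γE f := hY.outward_eq f hf hfo
      rw [hfV] at hi
      have hi0 : i ≠ 0 := by
        rintro rfl
        rw [tildeGamma_zero, one_mul] at hi
        have h1 : height e.fst = height u := congrArg (fun e : Edge p => height e.fst)
          (hY.eq_of_eq he hf hi)
        omega
      have hword : ∃ l, (∀ i ∈ l, i ≠ 0) ∧
          γE f * altProd ω γ true L = altProd ω γ false l := by
        -- Here `γ_f` is the empty word, so `γ̃_i` would meet the leading `γ̃` of `L`. This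
        -- collision occurs only when `e` ends at `v̂_*`, a situation in which `L` is assumed empty.
        by_cases hfs : f = eStar p
        · have hLnil : L = [] := hLe.resolve_right fun h => h.2 (by
            have : e.snd = vHat p := congrArg (fun e : Edge p => e.snd) hfs
            rw [this]
            exact beyond_vHat)
          refine ⟨[], by simp, ?_⟩
          rw [hfs, hY.eStar_eq, hLnil, altProd, altProd, one_mul]
        · have hub : height u + height e.snd ≤ n := by omega
          exact (ih f hub hf (hLe.imp_right fun h => ⟨fun hu' => h.2
            (Beyond.of_parent (w := u) hu' hadj (by omega)), h.2⟩)).2 hfo hfs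
      obtain ⟨l, hl, hl'⟩ := hword
      exact ⟨i :: l, List.cons_ne_nil _ _, List.forall_mem_cons.2 ⟨hi0, hl⟩,
        by rw [hi, mul_assoc, hl', altProd]⟩
    · obtain ⟨i, hi⟩ := hY.exists_index_source he
      have hout' := outward_iff.1 hout
      -- At the root `γ_e = γ_i`, with `i ≠ 0` because `e ≠ e_*`. This letter is the junction with
      -- `L`, and it alternates correctly with the `γ̃` that follows.
      by_cases hv : e.fst = vStar p
      · rw [hv, hY.vStar_eq, mul_one] at hi
        have hi0 : i ≠ 0 := by
          rintro rfl
          rw [hγ0, ← hY.eStar_eq] at hi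
          exact hne (hY.eq_of_eq he evenEdge_eStar hi)
        exact ⟨i :: L, List.forall_mem_cons.2 ⟨hi0, hL⟩, by rw [hi, altProd]⟩
      · obtain ⟨u, hadj, hu⟩ := exists_parent hv
        let f : Edge p := ⟨(e.fst, u), hadj⟩
        have hf : EvenEdge f := he
        have hfi : Inward f := inward_iff.2 hu
        have hfV : γV e.fst = γE f := hY.inward_eq f hf hfi
        rw [hfV] at hi
        have hi0 : i ≠ 0 := by
          rintro rfl
          rw [hγ0, one_mul] at hi
          have h1 : height e.snd = height u := congrArg (fun e : Edge p => height e.snd)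
            (hY.eq_of_eq he hf hi)
          omega
        have hub : height e.fst + height u ≤ n := by omega
        obtain ⟨l, -, hl, hl'⟩ := (ih f hub hf (hLe.imp_right fun h => ⟨h.1, fun hu' => h.1
          (Beyond.of_parent (w := u) hu' hadj (by omega))⟩)).1 hfi
        exact ⟨i :: l, List.forall_mem_cons.2 ⟨hi0, hl⟩, by rw [hi, mul_assoc, hl', altProd]⟩

theorem IsRadialSystem.isInwardWord (hY : IsRadialSystem ι R₀ ω γ γE γV) (hγ0 : γ 0 = 1)
    {e : Edge p} (he : EvenEdge e) (hin : Inward e) : IsInwardWord ω γ (γE e) := by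
  obtain ⟨l, hl, hl0, h⟩ := (hY.exists_word_mul hγ0 (L := []) (by simp) _ e le_rfl he
    (Or.inl rfl)).1 hin
  rw [altProd, mul_one] at h
  exact ⟨l, hl, hl0, h⟩

/-- Right multiplication by an inward word `y` maps `γ_e` to `γ_{y⁻¹e}`. -/
theorem IsRadialSystem.mul_inwardWord (hY : IsRadialSystem ι R₀ ω γ γE γV) (hγ0 : γ 0 = 1)
    (hγ : ∀ i, i ≠ 0 → γ i ≠ 1) (hγt : ∀ i, i ≠ 0 → tildeGamma ω γ i ≠ 1)
    {y : (ℍ[ℚ,a,b])ˣ} (hy : IsInwardWord ω γ y) {e : Edge p} (he : EvenEdge e)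
    (h : e = eStar p ∨ ¬ Beyond e.fst ∧ ¬ Beyond e.snd) :
    γE e * y = γE (locGL ι y⁻¹ • e) := by
  obtain ⟨L, hLne, hL, rfl⟩ := hy
  obtain ⟨f, hf, hfe⟩ : ∃ f, EvenEdge f ∧ γE f = γE e * altProd ω γ true L := by
    by_cases hes : e = eStar p
    · obtain ⟨f, hf, -, hfl⟩ := (hY.exists_edge_of_word hγ hγt L hL).2 hLne
      exact ⟨f, hf, by rw [hfl, hes, hY.eStar_eq, one_mul]⟩
    · have hw := hY.exists_word_mul hγ0 hL _ e le_rfl he (Or.inr (h.resolve_left hes))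
      rcases inward_or_outward e with hin | hout
      · obtain ⟨l, hlne, hl, hl'⟩ := hw.1 hin
        obtain ⟨f, hf, -, hfl⟩ := (hY.exists_edge_of_word hγ hγt l hl).2 hlne
        exact ⟨f, hf, by rw [hfl, hl']⟩
      · obtain ⟨l, hl, hl'⟩ := hw.2 hout hes
        obtain ⟨f, hf, -, hfl⟩ := (hY.exists_edge_of_word hγ hγt l hl).1
        exact ⟨f, hf, by rw [hfl, hl']⟩
  -- The edge `f` is determined by its group element: `f = (γ_e y)⁻¹ e_* = y⁻¹ e`.
  have h1 := hY.representsE f hf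
  rw [hfe, mul_inv_rev, map_mul, edge_mul_smul, hY.representsE e he] at h1
  rw [h1, hfe]

/-- `mul_inwardWord` applies to `g₀⁻¹e`, because `g₀` fixes both ends of `e_*` and so preserves
parity and the region behind `v̂_*`. Then `y` cancels in `γ_e g₀ y (γ_{g₀⁻¹e} y)⁻¹`. -/
theorem IsRadialSystem.hElt_mul_inwardWord (hY : IsRadialSystem ι R₀ ω γ γE γV) (hγ0 : γ 0 = 1)
    (hγ : ∀ i, i ≠ 0 → γ i ≠ 1) (hγt : ∀ i, i ≠ 0 → tildeGamma ω γ i ≠ 1)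
    {y : (ℍ[ℚ,a,b])ˣ} (hy : IsInwardWord ω γ y) {g₀ : (ℍ[ℚ,a,b])ˣ}
    (hg₀ : locGL ι g₀⁻¹ • eStar p = eStar p) {e : Edge p} (he : EvenEdge e)
    (h : e = eStar p ∨ ¬ Beyond e.fst ∧ ¬ Beyond e.snd) :
    hElt ι γE (g₀ * y) e = hElt ι γE g₀ e := by
  obtain ⟨h1, h2⟩ := smul_eStar_eq_iff.1 hg₀
  have he' : EvenEdge (locGL ι g₀⁻¹ • e) := by
    change Even (height (locGL ι g₀⁻¹ • e.fst))
    rw [height_smul h1]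
    exact he
  have h' : locGL ι g₀⁻¹ • e = eStar p ∨
      ¬ Beyond (locGL ι g₀⁻¹ • e).fst ∧ ¬ Beyond (locGL ι g₀⁻¹ • e).snd := by
    rcases h with rfl | h
    · exact Or.inl hg₀
    · right
      rwa [edge_smul_fst, edge_smul_snd, beyond_smul_iff h1 h2, beyond_smul_iff h1 h2]
  have h3 := hY.mul_inwardWord hγ0 hγ hγt hy he' h'
  rw [hElt, hElt, mul_inv_rev, map_mul, edge_mul_smul, ← h3]
  group

theorem IsRadialSystem.mu_mul_inwardWord (hY : IsRadialSystem ι R₀ ω γ γE γV) (hγ0 : γ 0 = 1)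
    (hγ : ∀ i, i ≠ 0 → γ i ≠ 1) (hγt : ∀ i, i ≠ 0 → tildeGamma ω γ i ≠ 1)
    {y : (ℍ[ℚ,a,b])ˣ} (hy : IsInwardWord ω γ y) {g₀ : (ℍ[ℚ,a,b])ˣ}
    (hg₀ : locGL ι g₀⁻¹ • eStar p = eStar p) (φ : gammaPM ι R₀ → ℤ) {e : Edge p}
    (he : ball e ⊆ zpBall p) : mu ι R₀ γE φ (g₀ * y) e = mu ι R₀ γE φ g₀ e := by
  have h := inward_of_ball_subset he
  by_cases heven : EvenEdge e
  · simp only [mu, if_pos heven]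
    rw [hY.hElt_mul_inwardWord hγ0 hγ hγt hy hg₀ heven (h.imp_right And.right)]
  · simp only [mu, if_neg heven]
    rw [hY.hElt_mul_inwardWord hγ0 hγ hγt hy hg₀ (evenEdge_symm_iff.2 heven)]
    -- An odd edge is handled through its opposite, which is outward. This is why both endpoints,
    -- and not the direction, are required to avoid the region behind `v̂_*`; `e_*` itself is even
    -- and does not occur.
    right
    rcases h with rfl | h
    · exact absurd evenEdge_eStar heven
    · exact ⟨h.2.2, h.2.1⟩

end Words
end DarmonPoints
end

/-! ### The proposition -/

theorem mainTheorem7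
    -- `B` is the quaternion algebra over `ℚ` of discriminant `D`
    (p D M : ℕ) [Fact p.Prime] (hD : 1 < D) (hDeven : Even D.primeFactors.card)
    (hDM : Nat.Coprime D M) (hp : ¬ p ∣ D * M)
    (a b : ℚ) (hB : HasDiscriminant a b D)
    -- `ι` is the isomorphism `ι_p`, and `R₀` the Eichler order `R₀(M)`
    (ι : ℚ_[p] ⊗[ℚ] ℍ[ℚ,a,b] ≃ₐ[ℚ_[p]] Matrix (Fin 2) (Fin 2) ℚ_[p])
    (R₀ : Subring ℍ[ℚ,a,b]) (hR₀ : IsEichlerOrder R₀ M) (hι : IsStandardAt ι R₀)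
    -- the choices of `γ_i` and `ω_p`, and the radial system that they determine
    (γ : Fin (p + 1) → (ℍ[ℚ,a,b])ˣ) (hγ : IsUpsilon ι R₀ γ)
    (ω : (ℍ[ℚ,a,b])ˣ) (hω : IsOmega ι R₀ ω)
    (γE : Edge p → (ℍ[ℚ,a,b])ˣ) (γV : Vertex p → (ℍ[ℚ,a,b])ˣ)
    (hY : IsRadialSystem ι R₀ ω γ γE γV)
    -- the cocycle `φ`, i.e. a homomorphism from `Γ₀ᴰ(pM)` to `ℤ`
    (φ : gammaPM ι R₀ → ℤ) (hφ : ∀ x y, φ (x * y) = φ x + φ y)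
    -- `g ∈ Γ` such that `g⁻¹ e_*` is inward
    (g : (ℍ[ℚ,a,b])ˣ) (hg : g ∈ bigGamma p R₀) (hin : Inward (locGL ι g⁻¹ • eStar p)) :
    -- `g` can be written as `g₀ y`
    (∃ g₀ ∈ gammaPM ι R₀, ∃ e, EvenEdge e ∧ IsInwardWord ω γ (γE e) ∧ g = g₀ * γE e) ∧
    -- and `μ_g` and `μ_{g₀}` coincide on `ℤ_p` for all such decompositions
    ∀ g₀ ∈ gammaPM ι R₀, ∀ y, IsInwardWord ω γ y → g = g₀ * y →
      (∀ e : Edge p, ball e ⊆ zpBall p → mu ι R₀ γE φ g e = mu ι R₀ γE φ g₀ e) ∧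
      (∀ m m₀ : Meas₀ p, Corresponds m (mu ι R₀ γE φ g) → Corresponds m₀ (mu ι R₀ γE φ g₀) →
        ∀ U : TopologicalSpace.CompactOpens (OnePoint ℚ_[p]),
          (U : Set (OnePoint ℚ_[p])) ⊆ zpBall p → m.val U = m₀.val U) := by
  have ha := hB.a_ne_zero
  have hfg := hR₀.toIntSubmodule_fg
  constructor
  · have he : EvenEdge (locGL ι g⁻¹ • eStar p) :=
      even_height_smul_vStar (norm_det_locGL ha (inv_mem hg))
    set e := locGL ι g⁻¹ • eStar p with hedef
    -- Both `g` and `γ_e` carry `e = g⁻¹e_*` to `e_*`, so `g γ_e⁻¹` stabilizes `e_*`.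
    refine ⟨g * (γE e)⁻¹, ?_, e, he, hY.isInwardWord hγ.zero he hin, by rw [inv_mul_cancel_right]⟩
    refine mem_gammaPM_of_smul_eStar ha hfg hι (mul_mem hg (inv_mem (hY.memE e he))) ?_
    rw [map_mul, edge_mul_smul, hY.representsE e he, hedef, ← edge_mul_smul, ← map_mul,
      mul_inv_cancel, map_one, edge_one_smul]
  · rintro g₀ hg₀ y hy rfl
    have hmu : ∀ e : Edge p, ball e ⊆ zpBall p →
        mu ι R₀ γE φ (g₀ * y) e = mu ι R₀ γE φ g₀ e := fun e he =>
      hY.mu_mul_inwardWord hγ.zero (fun _ => upsilon_ne_one hγ)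
        (fun _ => tildeGamma_ne_one ha hfg hι hγ hω) hy
        (gammaPM_smul_eStar ha (inv_mem hg₀)) φ he
    exact ⟨hmu, fun m m₀ hm hm₀ U hU => m.val_eq_of_corresponds hm hm₀ hmu hU⟩
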